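/- Proposition 2.1. Let $0<\alpha<1$, $M>0$, $C\in\mathbb R$, and let $\Omega$ be a real-valued function such that $x\mapsto\Omega(|x|)$ is $C^\infty$ on $\mathbb R^2$ and $$\Omega(s)=Cs^{-2}+\frac1{2-\alpha}s^{-\alpha}\qquad\text{for all } s\ge M .$$ Put $V(x)=\Omega(|x|)\,x^\perp$ with $x^\perp=(-x_2,x_1)$, $\operatorname{curl}V=\partial_1V_2-\partial_2V_1$, and let $\mathcal K(x)=\dfrac{x^\perp}{2\pi|x|^2}$ be the Biot–Savart kernel. For an integer $m\ge1$ let $L^2_m(\mathbb R^2)$ be the closed subspace of those complex-valued $\omega\in L^2(\mathbb R^2)$ that satisfy $\omega(x)=\omega(R_{2\pi/m}^{-1}x)$ for almost every $x$, where $R_\theta$ is the rotation by the angle $\theta$; and for $1<Q<2$ let $L^Q_m(\mathbb R^2)\cap L^2_m(\mathbb R^2)$ be the set of those elements of $L^2_m(\mathbb R^2)$ that also lie in $L^Q(\mathbb R^2)$. For $\omega$ in this set put $$\mathfrak A\omega=(\mathcal K*\omega,\partial)\operatorname{curl}V=\sum_{i=1}^2(\mathcal K*\omega)_i\,\partial_i\operatorname{curl}V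 .$$ Let $m\ge2$. For every $Q\in(1,2)$ the set $L^Q_m(\mathbb R^2)\cap L^2_m(\mathbb R^2)$ is dense in $L^2_m(\mathbb R^2)$, and for each $\omega$ in it the integrals defining $(\mathcal K*\omega)(x)$ converge absolutely for almost every $x$. There is a bounded linear operator $L^2_m(\mathbb R^2)\to L^2_m(\mathbb R^2)$, again denoted by $\mathfrak A$, which for every $Q\in(1,2)$ agrees with the above expression on $L^Q_m(\mathbb R^2)\cap L^2_m(\mathbb R^2)$ (by density it is the unique such extension). This operator is compact, and it belongs to the Schatten class $\mathfrak S_p(L^2_m(\mathbb R^2))$ for every $p>2$; that is, its nonzero singular numbers $\sigma_j$ (the square roots of the nonzero eigenvalues of $\mathfrak A^*\mathfrak A$, repeated according to multiplicity) satisfy $\sum_j\sigma_j^p<\infty$. -/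

import Mathlib

open MeasureTheory
open scoped Convolution

noncomputable section

/-- The Euclidean plane. -/
abbrev Plane : Type := EuclideanSpace ℝ (Fin 2)

/-- The quarter turn `x ↦ x^⊥ = (-x₂, x₁)`. -/
def perp (x : Plane) : Plane := !₂[-x 1, x 0]

/-- The `i`-th standard partial derivative `∂ᵢ φ`. -/
def partialDeriv {F : Type*} [NormedAddCommGroup F] [NormedSpace ℝ F]
    (i : Fin 2) (φ : Plane → F) (x : Plane) : F :=
  fderiv ℝ φ x (EuclideanSpace.single i 1)

/-- The scalar curl `∂₁ V₂ - ∂₂ V₁` of a plane vector field. -/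
def curl (V : Plane → Plane) (x : Plane) : ℝ :=
  partialDeriv 0 (fun y => V y 1) x - partialDeriv 1 (fun y => V y 0) x

/-- The circular velocity field `V(x) = Ω(|x|) x^⊥`. -/
def circularField (Ω : ℝ → ℝ) (x : Plane) : Plane := Ω ‖x‖ • perp x

/-- The Biot–Savart kernel `𝒦(x) = x^⊥ / (2π|x|²)`. -/
def biotSavartKernel (x : Plane) : Plane := (1 / (2 * Real.pi * ‖x‖ ^ 2)) • perp x

/-- The velocity `w = 𝒦 * ω`, componentwise, of a complex-valued vorticity `ω`. -/
def velocity (ω : Plane → ℂ) (x : Plane) (i : Fin 2) : ℂ :=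
  ((fun z => biotSavartKernel z i) ⋆[ContinuousLinearMap.lsmul ℝ ℝ, volume] ω) x

/-- Absolute convergence at `x` of the integrals that define `(𝒦 * ω)(x)`. -/
def VelocityExistsAt (ω : Plane → ℂ) (x : Plane) : Prop :=
  ∀ i : Fin 2, ConvolutionExistsAt (fun z => biotSavartKernel z i) ω x
    (ContinuousLinearMap.lsmul ℝ ℝ) volume

/-- The expression `(𝒦 * ω, ∂) curl V`. -/
def vorticityStretch (V : Plane → Plane) (ω : Plane → ℂ) (x : Plane) : ℂ :=
  ∑ i : Fin 2, velocity ω x i * ((partialDeriv i (curl V) x : ℝ) : ℂ)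

/-- The rotation `R_θ` of the plane, with matrix `(cos θ, -sin θ; sin θ, cos θ)`. -/
def planeRotation (θ : ℝ) : Plane →ₗᵢ[ℝ] Plane where
  toFun x := !₂[Real.cos θ * x 0 - Real.sin θ * x 1, Real.sin θ * x 0 + Real.cos θ * x 1]
  map_add' x y := by
    ext i; fin_cases i <;> simp <;> ring
  map_smul' c x := by
    ext i; fin_cases i <;> simp <;> ring
  norm_map' x := by
    rw [EuclideanSpace.norm_eq, EuclideanSpace.norm_eq]
    congr 1
    simp only [LinearMap.coe_mk, AddHom.coe_mk, Fin.sum_univ_two, Real.norm_eq_abs, sq_abs]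
    simp
    linear_combination (x 0 ^ 2 + x 1 ^ 2) * Real.sin_sq_add_cos_sq θ

theorem measurePreserving_planeRotation (θ : ℝ) :
    MeasurePreserving (planeRotation θ) (volume : Measure Plane) volume :=
  ((planeRotation θ).toLinearIsometryEquiv rfl).measurePreserving

/-- The complex Hilbert space `L²(ℝ²)`. -/
abbrev L2 : Type := Lp ℂ 2 (volume : Measure Plane)

/-- The subspace `L²_m(ℝ²)` of those `ω ∈ L²(ℝ²)` with `ω(x) = ω(R_{2π/m}⁻¹ x)`. -/
def L2m (m : ℕ) : Submodule ℂ L2 where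
  carrier := {ω | ∀ᵐ x ∂(volume : Measure Plane), ω x = ω (planeRotation (-(2 * Real.pi / m)) x)}
  zero_mem' := by
    have h := Lp.coeFn_zero ℂ 2 (volume : Measure Plane)
    have h' := (measurePreserving_planeRotation (-(2 * Real.pi / m))).quasiMeasurePreserving.ae h
    filter_upwards [h, h'] with x h1 h2
    rw [h1, h2]; rfl
  add_mem' := by
    intro f g hf hg
    simp only [Set.mem_ofPred_eq] at hf hg ⊢
    have h := Lp.coeFn_add f g
    have h' := (measurePreserving_planeRotation (-(2 * Real.pi / m))).quasiMeasurePreserving.ae h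
    filter_upwards [h, h', hf, hg] with x h1 h2 h3 h4
    rw [h1, h2, Pi.add_apply, Pi.add_apply, ← h3, ← h4]
  smul_mem' := by
    intro c f hf
    simp only [Set.mem_ofPred_eq] at hf ⊢
    have h := Lp.coeFn_smul c f
    have h' := (measurePreserving_planeRotation (-(2 * Real.pi / m))).quasiMeasurePreserving.ae h
    filter_upwards [h, h', hf] with x h1 h2 h3
    rw [h1, h2, Pi.smul_apply, Pi.smul_apply, ← h3]

theorem isClosed_L2m (m : ℕ) : IsClosed (L2m m : Set L2) := by
  have hmp := measurePreserving_planeRotation (-(2 * Real.pi / m))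
  have hc : Continuous (Lp.compMeasurePreserving (p := 2) (E := ℂ) _ hmp) :=
    haveI : Fact ((1 : ENNReal) ≤ 2) := inferInstance
    (Lp.isometry_compMeasurePreserving hmp).continuous
  have : (L2m m : Set L2) = {ω : L2 | ω = Lp.compMeasurePreserving _ hmp ω} := by
    ext ω
    have h := Lp.coeFn_compMeasurePreserving ω hmp
    constructor
    · intro hω
      apply Lp.ext
      exact Filter.EventuallyEq.trans hω h.symm
    · intro hω
      have h2 : (ω : Plane → ℂ) =ᵐ[volume] (Lp.compMeasurePreserving _ hmp ω : L2) := by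
        rw [← (show ω = _ from hω)]
      exact h2.trans h
  rw [this]
  exact isClosed_eq continuous_id hc

instance (m : ℕ) : CompleteSpace (L2m m) := (isClosed_L2m m).completeSpace_coe

/-- The subspace `L^Q_m(ℝ²) ∩ L²_m(ℝ²)` of `L²_m(ℝ²)`. -/
def LQm (Q : ENNReal) (m : ℕ) : Set (L2m m) :=
  {ω | MemLp (ω : L2) Q (volume : Measure Plane)}

section Schatten

variable {H : Type*} [NormedAddCommGroup H] [InnerProductSpace ℂ H] [CompleteSpace H]

/-- The multiplicity of `σ > 0` as a singular number of `T`, i.e. the dimension of the eigenspace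
of `T* T` for the eigenvalue `σ²`; it is finite if `T` is compact. -/
def singularMultiplicity (T : H →L[ℂ] H) (σ : ℝ) : ℕ :=
  Module.finrank ℂ (Module.End.eigenspace
    ((ContinuousLinearMap.adjoint T ∘L T : H →L[ℂ] H) : Module.End ℂ H) ((σ : ℂ) ^ 2))

/-- The Schatten class `𝔖_p(H)`, `0 < p < ∞`: the compact operators whose nonzero singular
numbers, repeated according to multiplicity, have a finite sum of `p`-th powers. -/
def MemSchatten (p : ℝ) (T : H →L[ℂ] H) : Prop :=
  IsCompactOperator T ∧
    Summable fun σ : Set.Ioi (0 : ℝ) => (singularMultiplicity T σ : ℝ) * (σ : ℝ) ^ p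

end Schatten

end

/-! The expression is an integral operator with kernel `(∇ curl V(x), 𝒦(x - y))`. Beyond radius `M`
the curl is exactly `|x|^(-α)`, because the term `C s^(-2)` carries no vorticity; hence the gradient
of the curl is `O((1 + |x|)^(-1-α))` on the plane.

The kernel `𝒦` just fails to be square integrable, both at the origin and at infinity. At infinity
symmetry helps: the integral of `𝒦(-y) ω(y)` over `|y| ≥ 1` is a vector fixed by the rotation by
`-2π/m`, so it vanishes for `m ≥ 2`. Subtracting `𝒦(-y)` for `|y| ≥ 1` therefore does not change the
operator on `L^Q_m ∩ L²_m`, while the new kernel decays like `|x| / |y|²` and defines a bounded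
operator on all of `L²`.

On the diagonal the kernel is cut at `|x - y| = ε`. The near part has norm `O(√ε)` by Schur's test
(`exists_nearOperator`); the far part has squared Hilbert–Schmidt norm `O(ε^(-δ))` for every small
`δ > 0` (`lintegral_sq_farKernel_le`). With `ε = t²` the operator is within `O(t)` of operators
whose squared Hilbert–Schmidt norm is `t^(-δ)` up to a constant.

Such an approximation bounds the sum of the squares of the singular numbers of size about `t` by
`O(t^(-δ))`, so their `p`-th powers sum to `O(t^(p-2-δ))`. Summing over dyadic `t` gives the
Schatten property for `p > 2 + δ` (`memSchatten_of_approx`), and `δ` is arbitrarily small. -/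

/-! ### Hilbert–Schmidt bounds and compactness -/

section HilbertSchmidt

variable {H G : Type*} [NormedAddCommGroup H] [InnerProductSpace ℂ H]
  [NormedAddCommGroup G] [InnerProductSpace ℂ G]

/-- The square of the Hilbert–Schmidt norm of `B` is at most `D`. -/
def HilbertSchmidtLE (B : H →L[ℂ] G) (D : ℝ) : Prop :=
  ∀ (ι : Type) [Fintype ι] (e : ι → H), Orthonormal ℂ e → ∑ i, ‖B (e i)‖ ^ 2 ≤ D

theorem HilbertSchmidtLE.nonneg {B : H →L[ℂ] G} {D : ℝ} (hB : HilbertSchmidtLE B D) : 0 ≤ D := by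
  simpa using hB (Fin 0) ![] ⟨by simp, by intro i; exact i.elim0⟩

/-- Take a finite orthonormal system whose sum of `‖B e‖²` is within `η²` of the supremum. A unit
vector `v` orthogonal to it can be adjoined, so `‖B v‖² < η²`: `B` is small on the orthogonal
complement of the span. -/
theorem HilbertSchmidtLE.exists_finiteDimensional_approx {B : H →L[ℂ] G} {D : ℝ}
    (hB : HilbertSchmidtLE B D) {η : ℝ} (hη : 0 < η) :
    ∃ (W : Submodule ℂ H) (_ : FiniteDimensional ℂ W), ‖B - B ∘L W.starProjection‖ ≤ η := by
  set S : Set ℝ := {s | ∃ (n : ℕ) (e : Fin n → H), Orthonormal ℂ e ∧ s = ∑ i, ‖B (e i)‖ ^ 2}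
  have hne : S.Nonempty := ⟨0, 0, ![], ⟨by simp, by intro i; exact i.elim0⟩, by simp⟩
  have hbdd : BddAbove S := ⟨D, by rintro _ ⟨n, e, he, rfl⟩; exact hB _ e he⟩
  obtain ⟨_, ⟨n, e, he, rfl⟩, hs⟩ := exists_lt_of_lt_csSup hne
    (show sSup S - η ^ 2 < sSup S by linarith [pow_pos hη 2])
  have hfin : FiniteDimensional ℂ (Submodule.span ℂ (Set.range e)) :=
    FiniteDimensional.span_of_finite ℂ (Set.finite_range e)
  refine ⟨Submodule.span ℂ (Set.range e), hfin, ?_⟩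
  refine ContinuousLinearMap.opNorm_le_bound _ hη.le fun x => ?_
  set W := Submodule.span ℂ (Set.range e)
  set u := x - W.starProjection x
  have hu : u ∈ Wᗮ := Submodule.sub_starProjection_mem_orthogonal x
  have hux : ‖u‖ ≤ ‖x‖ := by
    have h : u = Wᗮ.starProjection x := by
      rw [Submodule.starProjection_orthogonal']; simp [u]
    rw [h]
    exact (Wᗮ.starProjection.le_opNorm x).trans
      (mul_le_of_le_one_left (norm_nonneg _) Wᗮ.starProjection_norm_le)
  have hBu : (B - B ∘L W.starProjection) x = B u := by simp [u]
  rw [hBu]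
  refine le_trans ?_ (mul_le_mul_of_nonneg_left hux hη.le)
  rcases eq_or_ne u 0 with h0 | h0
  · simp [h0]
  have hun : 0 < ‖u‖ := norm_pos_iff.2 h0
  set v : H := ((‖u‖⁻¹ : ℝ) : ℂ) • u
  have hv : ‖v‖ = 1 := by simp [v, norm_smul, hun.ne']
  have hvW : v ∈ Wᗮ := Wᗮ.smul_mem _ hu
  have ho : Orthonormal ℂ (Matrix.vecCons v e) := by
    refine orthonormal_vecCons_iff.2 ⟨hv, fun i => ?_, he⟩
    have hei : e i ∈ W := Submodule.subset_span ⟨i, rfl⟩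
    exact Submodule.inner_left_of_mem_orthogonal hei hvW
  have hmem : ∑ i, ‖B (Matrix.vecCons v e i)‖ ^ 2 ∈ S := ⟨_, _, ho, rfl⟩
  have hle := le_csSup hbdd hmem
  rw [Fin.sum_univ_succ] at hle
  simp only [Matrix.cons_val_zero, Matrix.cons_val_succ] at hle
  have hlt : ‖B v‖ ^ 2 < η ^ 2 := by linarith
  have hlt' : ‖B v‖ ≤ η := (lt_of_pow_lt_pow_left₀ 2 hη.le hlt).le
  have hBv : ‖B v‖ = ‖u‖⁻¹ * ‖B u‖ := by simp [v, norm_smul]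
  rw [hBv, inv_mul_le_iff₀ hun] at hlt'
  linarith

theorem isCompactOperator_of_norm_sub_le [CompleteSpace G] {A : H →L[ℂ] G}
    (h : ∀ η > 0, ∃ B : H →L[ℂ] G, IsCompactOperator B ∧ ‖A - B‖ ≤ η) : IsCompactOperator A := by
  have hc : A ∈ closure {f : H →L[ℂ] G | IsCompactOperator f} := by
    refine Metric.mem_closure_iff.2 fun η hη => ?_
    obtain ⟨B, hB, hAB⟩ := h (η / 2) (half_pos hη)
    exact ⟨B, hB, by rw [dist_eq_norm]; linarith⟩
  rwa [isClosed_setOfPred_isCompactOperator.closure_eq] at hc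

theorem HilbertSchmidtLE.isCompactOperator [CompleteSpace G] {B : H →L[ℂ] G} {D : ℝ}
    (hB : HilbertSchmidtLE B D) : IsCompactOperator B := by
  refine isCompactOperator_of_norm_sub_le fun η hη => ?_
  obtain ⟨W, hW, h⟩ := hB.exists_finiteDimensional_approx hη
  refine ⟨B ∘L W.starProjection, ?_, h⟩
  have : ProperSpace W := FiniteDimensional.proper ℂ W
  have h1 : IsCompactOperator (id : W → W) :=
    isCompactOperator_id_iff_locallyCompactSpace.2 inferInstance
  exact (h1.comp_clm W.orthogonalProjectionOnto).clm_comp (B ∘L W.subtypeL)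

/-- In infinite dimension `finrank` is `0` and the empty family serves, so multiplicities can be
counted before compactness is known. -/
theorem exists_orthonormal_fin_finrank (E : Submodule ℂ H) :
    ∃ v : Fin (Module.finrank ℂ E) → E, Orthonormal ℂ v := by
  by_cases h : FiniteDimensional ℂ E
  · exact ⟨stdOrthonormalBasis ℂ E, (stdOrthonormalBasis ℂ E).orthonormal⟩
  · rw [Module.finrank_of_not_finite h]
    exact ⟨![], ⟨by simp, by intro i; exact i.elim0⟩⟩

end HilbertSchmidt

/-! ### Singular numbers and Schatten classes -/

section SingularNumbers

variable {H : Type*} [NormedAddCommGroup H] [InnerProductSpace ℂ H] [CompleteSpace H]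

theorem norm_apply_of_mem_eigenspace (T : H →L[ℂ] H) {σ : ℝ} (hσ : 0 ≤ σ) {x : H}
    (hx : x ∈ Module.End.eigenspace
      ((ContinuousLinearMap.adjoint T ∘L T : H →L[ℂ] H) : Module.End ℂ H) ((σ : ℂ) ^ 2)) :
    ‖T x‖ = σ * ‖x‖ := by
  have h1 : ContinuousLinearMap.adjoint T (T x) = ((σ : ℂ) ^ 2) • x :=
    Module.End.mem_eigenspace_iff.1 hx
  have h2 : inner ℂ (ContinuousLinearMap.adjoint T (T x)) x = inner ℂ (T x) (T x) :=
    ContinuousLinearMap.adjoint_inner_left T x (T x)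
  rw [h1, inner_smul_left, inner_self_eq_norm_sq_to_K, inner_self_eq_norm_sq_to_K] at h2
  have h3 : σ ^ 2 * ‖x‖ ^ 2 = ‖T x‖ ^ 2 := by
    refine Complex.ofReal_injective ?_
    push_cast
    simpa using h2
  rw [← mul_pow] at h3
  exact ((sq_eq_sq₀ (by positivity) (norm_nonneg _)).1 h3).symm

theorem exists_orthonormal_singularVectors (T : H →L[ℂ] H) (F : Finset (Set.Ioi (0 : ℝ))) :
    ∃ e : (Σ σ : F, Fin (singularMultiplicity T σ.1)) → H, Orthonormal ℂ e ∧
      ∀ i, ‖T (e i)‖ = i.1.1 := by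
  set S : Module.End ℂ H := ((ContinuousLinearMap.adjoint T ∘L T : H →L[ℂ] H) : Module.End ℂ H)
  have hS : S.IsSymmetric := by
    intro x y
    simp [S, ContinuousLinearMap.adjoint_inner_left, ContinuousLinearMap.adjoint_inner_right]
  have hinj : Function.Injective fun σ : F => (((σ.1 : ℝ) : ℂ) ^ 2) := by
    intro σ τ h
    have h' : ((σ.1 : ℝ)) ^ 2 = (τ.1 : ℝ) ^ 2 := by
      refine Complex.ofReal_injective ?_
      push_cast
      exact h
    exact Subtype.ext (Subtype.ext ((sq_eq_sq₀ (le_of_lt σ.1.2) (le_of_lt τ.1.2)).1 h'))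
  have hO := hS.orthogonalFamily_eigenspaces.comp hinj
  choose v hv using fun σ : F =>
    exists_orthonormal_fin_finrank (Module.End.eigenspace S (((σ.1 : ℝ) : ℂ) ^ 2))
  refine ⟨fun i => v i.1 i.2, hO.orthonormal_sigma_orthonormal hv, fun i => ?_⟩
  have h := norm_apply_of_mem_eigenspace T (le_of_lt i.1.1.2) (v i.1 i.2).2
  have hn : ‖((v i.1 i.2 : _) : H)‖ = 1 := (hv i.1).1 i.2
  rw [h, hn, mul_one]

/-- On a unit singular vector `e` with `σ ≥ 2ε` one has `‖T e‖ = σ` and `‖T e - B e‖ ≤ ε ≤ σ / 2`,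
hence `σ ≤ 2 ‖B e‖`. Singular vectors for distinct `σ` are orthogonal, so the Hilbert–Schmidt bound
applies to all of them at once. -/
theorem sum_singularMultiplicity_mul_sq_le {T B : H →L[ℂ] H} {D ε : ℝ}
    (hB : HilbertSchmidtLE B D) (hTB : ‖T - B‖ ≤ ε) (F : Finset (Set.Ioi (0 : ℝ)))
    (hF : ∀ σ ∈ F, 2 * ε ≤ σ) :
    ∑ σ ∈ F, (singularMultiplicity T σ : ℝ) * (σ : ℝ) ^ 2 ≤ 4 * D := by
  obtain ⟨e, he, hTe⟩ := exists_orthonormal_singularVectors T F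
  have hsum : ∑ σ ∈ F, (singularMultiplicity T σ : ℝ) * (σ : ℝ) ^ 2
      = ∑ i : (Σ σ : F, Fin (singularMultiplicity T σ.1)), (i.1.1 : ℝ) ^ 2 := by
    rw [Fintype.sum_sigma, ← Finset.sum_coe_sort F]
    simp
  rw [hsum]
  calc _ ≤ ∑ i, 4 * ‖B (e i)‖ ^ 2 := by
        refine Finset.sum_le_sum fun i _ => ?_
        have h1 : ‖(T - B) (e i)‖ ≤ ε := by
          simpa [he.1 i] using ((T - B).le_opNorm (e i)).trans
            (mul_le_mul_of_nonneg_right hTB (norm_nonneg _))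
        have h2 : ‖T (e i)‖ ≤ ‖(T - B) (e i)‖ + ‖B (e i)‖ := by
          simpa using norm_add_le ((T - B) (e i)) (B (e i))
        have h3 := hF i.1.1 i.1.2
        rw [hTe i] at h2
        have h4 : (i.1.1 : ℝ) ≤ 2 * ‖B (e i)‖ := by linarith
        have h5 : (0 : ℝ) < i.1.1 := i.1.1.2
        nlinarith
    _ = 4 * ∑ i, ‖B (e i)‖ ^ 2 := by rw [Finset.mul_sum]
    _ ≤ 4 * D := by linarith [hB _ e he]

theorem le_norm_of_singularMultiplicity_ne_zero (T : H →L[ℂ] H) {σ : ℝ} (hσ : 0 < σ)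
    (h : singularMultiplicity T σ ≠ 0) : σ ≤ ‖T‖ := by
  obtain ⟨e, he, hTe⟩ := exists_orthonormal_singularVectors T {⟨σ, hσ⟩}
  have i : (Σ σ' : ({⟨σ, hσ⟩} : Finset (Set.Ioi (0 : ℝ))), Fin (singularMultiplicity T σ'.1)) :=
    ⟨⟨⟨σ, hσ⟩, by simp⟩, ⟨0, Nat.pos_of_ne_zero h⟩⟩
  have h1 := T.le_opNorm (e i)
  rw [hTe i, he.1 i, mul_one] at h1
  have : i.1.1 = ⟨σ, hσ⟩ := Finset.mem_singleton.1 i.1.2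
  rwa [this] at h1

/-- An operator that is approximated up to `K t` by operators of squared Hilbert–Schmidt norm
`O(t ^ (-δ))` lies in the Schatten class of every order `p > 2 + δ`. -/
theorem memSchatten_of_approx (T : H →L[ℂ] H) {K D δ p : ℝ} (hδ : 0 ≤ δ) (hp : 2 + δ < p)
    (h : ∀ t : ℝ, 0 < t → t ≤ 1 →
      ∃ B : H →L[ℂ] H, ‖T - B‖ ≤ K * t ∧ HilbertSchmidtLE B (D * t ^ (-δ))) :
    MemSchatten p T := by
  have hD : 0 ≤ D := by
    obtain ⟨B, -, hB⟩ := h 1 one_pos le_rfl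
    simpa using hB.nonneg
  -- A single scale: it dominates the approximation constant `K` and lies strictly above every
  -- singular number.
  set L : ℝ := max K (‖T‖ + 1)
  have hL : 0 < L := lt_max_of_lt_right (by positivity)
  have hTL : ‖T‖ < L := lt_max_of_lt_right (by linarith)
  have hKL : K ≤ L := le_max_left _ _
  refine ⟨isCompactOperator_of_norm_sub_le fun η hη => ?_, ?_⟩
  · obtain ⟨B, hTB, hB⟩ := h (min 1 (η / L)) (lt_min one_pos (by positivity)) (min_le_left _ _)
    refine ⟨B, hB.isCompactOperator, hTB.trans ?_⟩
    calc K * min 1 (η / L) ≤ L * (η / L) :=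
          mul_le_mul hKL (min_le_right _ _) (le_min zero_le_one (by positivity)) hL.le
      _ = η := by field_simp
  -- With `t = 2^(-n)`, the `n`-th dyadic block will be bounded by a constant times `t^(p-2) t^(-δ)
  -- = q^n`.
  set q : ℝ := (2 : ℝ) ^ (-(p - 2 - δ))
  have hq0 : 0 ≤ q := by positivity
  have hq1 : q < 1 := Real.rpow_lt_one_of_one_lt_of_neg (by norm_num) (by linarith)
  set a : ℕ → ℝ := fun n => (4 * L) ^ (p - 2) * (4 * D) * q ^ n
  have ha : Summable a := (summable_geometric_of_lt_one hq0 hq1).mul_left _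
  have ha0 : ∀ n, 0 ≤ a n := fun n => by positivity
  refine summable_of_sum_le (c := ∑' n, a n) (fun σ => ?_) fun F => ?_
  · have : (0 : ℝ) ≤ σ := le_of_lt σ.2
    exact mul_nonneg (Nat.cast_nonneg _) (Real.rpow_nonneg this _)
  have hex : ∀ σ : Set.Ioi (0 : ℝ), ∃ n : ℕ, 2 * L * (1 / 2) ^ n ≤ σ := fun σ => by
    obtain ⟨n, hn⟩ := exists_pow_lt_of_lt_one (show 0 < (σ : ℝ) / (2 * L) from
      div_pos σ.2 (by positivity)) (show (1 / 2 : ℝ) < 1 by norm_num)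
    refine ⟨n, ?_⟩
    rw [lt_div_iff₀ (by positivity)] at hn
    linarith
  classical
  -- Dyadic index: an actual singular number satisfies `2L · 2^(-N) ≤ σ ≤ 4L · 2^(-N)`. The lower
  -- bound is the threshold `2ε ≤ σ` with `ε = L t`.
  set N : Set.Ioi (0 : ℝ) → ℕ := fun σ => Nat.find (hex σ)
  have hN : ∀ σ, 2 * L * (1 / 2) ^ N σ ≤ σ := fun σ => Nat.find_spec (hex σ)
  have hN' : ∀ σ : Set.Ioi (0 : ℝ), singularMultiplicity T σ ≠ 0 →
      (σ : ℝ) ≤ 4 * L * (1 / 2) ^ N σ := fun σ hσ => by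
    have h1 : (σ : ℝ) ≤ ‖T‖ := le_norm_of_singularMultiplicity_ne_zero T σ.2 hσ
    -- Index `0` has no predecessor to violate; there the upper bound comes from `σ ≤ ‖T‖ < L`.
    rcases hn : N σ with _ | k
    · simp; linarith
    · have : ¬ 2 * L * (1 / 2) ^ k ≤ σ := Nat.find_min (hex σ) (by change k < N σ; omega)
      rw [pow_succ]; linarith
  rw [← Finset.sum_fiberwise_of_maps_to (t := F.image N) fun σ hσ => Finset.mem_image_of_mem N hσ]
  refine (Finset.sum_le_sum fun n _ => ?_).trans (ha.sum_le_tsum _ fun n _ => ha0 n)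
  set t : ℝ := (1 / 2) ^ n
  have ht : 0 < t := by positivity
  obtain ⟨B, hTB, hB⟩ := h t ht (pow_le_one₀ (by norm_num) (by norm_num))
  have key := sum_singularMultiplicity_mul_sq_le hB
    (hTB.trans (mul_le_mul_of_nonneg_right hKL ht.le)) {σ ∈ F | N σ = n} (by
      intro σ hσ
      rw [Finset.mem_filter] at hσ
      have := hN σ
      rw [hσ.2] at this
      linarith)
  calc ∑ σ ∈ F with N σ = n, (singularMultiplicity T σ : ℝ) * (σ : ℝ) ^ p
      ≤ ∑ σ ∈ F with N σ = n, (4 * L * t) ^ (p - 2) *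
          ((singularMultiplicity T σ : ℝ) * (σ : ℝ) ^ 2) := by
        refine Finset.sum_le_sum fun σ hσ => ?_
        rcases eq_or_ne (singularMultiplicity T σ) 0 with h0 | h0
        · simp [h0]
        rw [Finset.mem_filter] at hσ
        have h1 := hN' σ h0
        rw [hσ.2] at h1
        have hσ0 : (0 : ℝ) < σ := σ.2
        have h2 : (σ : ℝ) ^ p = (σ : ℝ) ^ (p - 2) * (σ : ℝ) ^ 2 := by
          rw [← Real.rpow_natCast, ← Real.rpow_add hσ0]; congr 1; push_cast; ring
        have h3 : (σ : ℝ) ^ (p - 2) ≤ (4 * L * t) ^ (p - 2) :=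
          Real.rpow_le_rpow hσ0.le h1 (by linarith)
        rw [h2, mul_left_comm]
        exact mul_le_mul_of_nonneg_right h3 (by positivity)
    _ = (4 * L * t) ^ (p - 2) *
          ∑ σ ∈ F with N σ = n, (singularMultiplicity T σ : ℝ) * (σ : ℝ) ^ 2 := by
        rw [Finset.mul_sum]
    _ ≤ (4 * L * t) ^ (p - 2) * (4 * (D * t ^ (-δ))) :=
        mul_le_mul_of_nonneg_left key (by positivity)
    _ = (4 * L) ^ (p - 2) * (4 * D) * (t ^ (p - 2) * t ^ (-δ)) := by
        rw [Real.mul_rpow (by positivity) ht.le]; ring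
    _ = a n := by
        have : t ^ (p - 2) * t ^ (-δ) = q ^ n := by
          rw [← Real.rpow_add ht, ← Real.rpow_natCast, ← Real.rpow_mul (by norm_num)]
          simp only [t, one_div, inv_pow]
          rw [← Real.rpow_natCast, ← Real.rpow_neg (by norm_num), ← Real.rpow_mul (by norm_num)]
          congr 1; ring
        rw [this]

end SingularNumbers

/-! ### Integral operators on `L²`: Schur's test and Hilbert–Schmidt kernels -/

section IntegralOperators

open scoped ENNReal

variable {X : Type*} [MeasurableSpace X] {μ : Measure X}

theorem eLpNorm_two_sq (f : X → ℂ) : eLpNorm f 2 μ ^ 2 = ∫⁻ x, ‖f x‖ₑ ^ 2 ∂μ := by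
  have h := eLpNorm_nnreal_pow_eq_lintegral (μ := μ) (f := f) (p := 2) (by norm_num)
  simpa using h

theorem ofReal_norm_Lp_two_sq (f : Lp ℂ 2 μ) :
    ENNReal.ofReal (‖f‖ ^ 2) = ∫⁻ x, ‖f x‖ₑ ^ 2 ∂μ := by
  rw [← eLpNorm_two_sq, ENNReal.ofReal_pow (norm_nonneg _), Lp.norm_def,
    ENNReal.ofReal_toReal (Lp.eLpNorm_ne_top f)]

theorem memLp_two_iff_lintegral {f : X → ℂ} (hf : AEStronglyMeasurable f μ) :
    MemLp f 2 μ ↔ ∫⁻ x, ‖f x‖ₑ ^ 2 ∂μ < ∞ := by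
  rw [← eLpNorm_two_sq]
  constructor
  · intro h
    exact ENNReal.pow_lt_top h.2
  · intro h
    exact ⟨hf, lt_top_iff_ne_top.2 fun h' => by simp [h'] at h⟩

theorem lintegral_mul_sq_le {f g : X → ℝ≥0∞} (hf : AEMeasurable f μ) (hg : AEMeasurable g μ) :
    (∫⁻ x, f x * g x ∂μ) ^ 2 ≤ (∫⁻ x, f x ^ 2 ∂μ) * ∫⁻ x, g x ^ 2 ∂μ := by
  have h := ENNReal.lintegral_mul_le_Lp_mul_Lq μ Real.HolderConjugate.two_two hf hg
  have h2 := pow_le_pow_left' h 2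
  simp only [Pi.mul_apply, ENNReal.rpow_ofNat] at h2
  rw [mul_pow, ← ENNReal.rpow_natCast (_ ^ (1 / 2 : ℝ)), ← ENNReal.rpow_natCast (_ ^ (1 / 2 : ℝ)),
    ← ENNReal.rpow_mul, ← ENNReal.rpow_mul] at h2
  simpa using h2

/-- The integral operator with kernel `k`: the defining integrals converge absolutely a.e. -/
def IsIntegralOperator (k : X → X → ℂ) (T : Lp ℂ 2 μ →L[ℂ] Lp ℂ 2 μ) : Prop :=
  ∀ ω : Lp ℂ 2 μ, ∀ᵐ x ∂μ, Integrable (fun y => k x y * ω y) μ ∧ T ω x = ∫ y, k x y * ω y ∂μ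

variable [SFinite μ]

/-- An estimate on nonnegative functions is enough: applied to `|ω|` it makes the inner integral
finite for almost every `x`, which gives absolute convergence, linearity and the norm bound
together. -/
theorem exists_isIntegralOperator {k : X → X → ℂ} (hk : Measurable (Function.uncurry k)) {N : ℝ}
    (hN : 0 ≤ N) (h : ∀ f : X → ℝ≥0∞, Measurable f →
      ∫⁻ x, (∫⁻ y, ‖k x y‖ₑ * f y ∂μ) ^ 2 ∂μ ≤ ENNReal.ofReal N ^ 2 * ∫⁻ y, f y ^ 2 ∂μ) :
    ∃ T : Lp ℂ 2 μ →L[ℂ] Lp ℂ 2 μ, ‖T‖ ≤ N ∧ IsIntegralOperator k T := by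
  have hω : ∀ ω : Lp ℂ 2 μ, Measurable ω := fun ω => (Lp.stronglyMeasurable ω).measurable
  have hm : ∀ ω : Lp ℂ 2 μ, StronglyMeasurable fun x => ∫ y, k x y * ω y ∂μ := fun ω => by
    refine StronglyMeasurable.integral_prod_right ?_
    exact (hk.mul ((hω ω).comp measurable_snd)).stronglyMeasurable
  have hle : ∀ ω : Lp ℂ 2 μ, ∫⁻ x, (∫⁻ y, ‖k x y‖ₑ * ‖ω y‖ₑ ∂μ) ^ 2 ∂μ ≤
      ENNReal.ofReal (N * ‖ω‖) ^ 2 := fun ω => by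
    refine (h _ (hω ω).enorm).trans_eq ?_
    rw [← ofReal_norm_Lp_two_sq, ENNReal.ofReal_mul hN, mul_pow,
      ENNReal.ofReal_pow (norm_nonneg ω)]
  have hint : ∀ ω : Lp ℂ 2 μ, ∀ᵐ x ∂μ, Integrable (fun y => k x y * ω y) μ := fun ω => by
    have hmeas : Measurable fun x => (∫⁻ y, ‖k x y‖ₑ * ‖ω y‖ₑ ∂μ) ^ 2 := by
      refine Measurable.pow_const (Measurable.lintegral_prod_right ?_) 2
      exact hk.enorm.mul ((hω ω).comp measurable_snd).enorm
    filter_upwards [ae_lt_top hmeas ((hle ω).trans_lt (by simp)).ne] with x hx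
    refine ⟨((hk.comp measurable_prodMk_left).mul (hω ω)).aestronglyMeasurable, ?_⟩
    have hx' : ∫⁻ y, ‖k x y‖ₑ * ‖ω y‖ₑ ∂μ < ∞ :=
      lt_top_iff_ne_top.2 fun h' => by simp [h'] at hx
    simpa [HasFiniteIntegral, enorm_mul] using hx'
  have hnorm : ∀ ω : Lp ℂ 2 μ, eLpNorm (fun x => ∫ y, k x y * ω y ∂μ) 2 μ ≤
      ENNReal.ofReal (N * ‖ω‖) := fun ω => by
    refine (ENNReal.pow_le_pow_left_iff two_ne_zero).1 ?_
    rw [eLpNorm_two_sq]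
    refine le_trans (lintegral_mono fun x => pow_le_pow_left' ?_ 2) (hle ω)
    refine (enorm_integral_le_lintegral_enorm _).trans_eq ?_
    simp [enorm_mul]
  have hmem : ∀ ω : Lp ℂ 2 μ, MemLp (fun x => ∫ y, k x y * ω y ∂μ) 2 μ := fun ω =>
    ⟨(hm ω).aestronglyMeasurable, (hnorm ω).trans_lt (by simp)⟩
  let T₀ : Lp ℂ 2 μ →ₗ[ℂ] Lp ℂ 2 μ :=
    { toFun := fun ω => (hmem ω).toLp _
      map_add' := fun ω ω' => by
        apply Lp.ext
        filter_upwards [(hmem (ω + ω')).coeFn_toLp, (hmem ω).coeFn_toLp, (hmem ω').coeFn_toLp,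
          Lp.coeFn_add ((hmem ω).toLp _) ((hmem ω').toLp _), hint ω, hint ω']
          with x h1 h2 h3 h4 h5 h6
        rw [h1, h4, Pi.add_apply, h2, h3, ← integral_add h5 h6]
        refine integral_congr_ae ?_
        filter_upwards [Lp.coeFn_add ω ω'] with y hy
        rw [hy, Pi.add_apply, mul_add]
      map_smul' := fun c ω => by
        apply Lp.ext
        filter_upwards [(hmem (c • ω)).coeFn_toLp, (hmem ω).coeFn_toLp,
          Lp.coeFn_smul c ((hmem ω).toLp _)] with x h1 h2 h3
        rw [h1, RingHom.id_apply, h3, Pi.smul_apply, h2, ← integral_smul]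
        refine integral_congr_ae ?_
        filter_upwards [Lp.coeFn_smul c ω] with y hy
        rw [hy, Pi.smul_apply, smul_eq_mul, smul_eq_mul, mul_left_comm] }
  have hT₀ : ∀ ω, ‖T₀ ω‖ ≤ N * ‖ω‖ := fun ω => by
    change ‖(hmem ω).toLp _‖ ≤ _
    rw [Lp.norm_toLp]
    exact ENNReal.toReal_le_of_le_ofReal (by positivity) (hnorm ω)
  refine ⟨T₀.mkContinuous N hT₀, LinearMap.mkContinuous_norm_le _ hN _, fun ω => ?_⟩
  filter_upwards [hint ω, (hmem ω).coeFn_toLp] with x h1 h2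
  exact ⟨h1, h2⟩

/-- Schur's test. -/
theorem exists_isIntegralOperator_of_schur {k : X → X → ℂ} (hk : Measurable (Function.uncurry k))
    {N : ℝ} (hN : 0 ≤ N) (h₁ : ∀ x, ∫⁻ y, ‖k x y‖ₑ ∂μ ≤ ENNReal.ofReal N)
    (h₂ : ∀ y, ∫⁻ x, ‖k x y‖ₑ ∂μ ≤ ENNReal.ofReal N) :
    ∃ T : Lp ℂ 2 μ →L[ℂ] Lp ℂ 2 μ, ‖T‖ ≤ N ∧ IsIntegralOperator k T := by
  refine exists_isIntegralOperator hk hN fun f hf => ?_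
  have hkx : ∀ x, Measurable fun y => ‖k x y‖ₑ := fun x => (hk.comp measurable_prodMk_left).enorm
  have hky : ∀ y, Measurable fun x => ‖k x y‖ₑ := fun y => (hk.comp measurable_prodMk_right).enorm
  have hsq : ∀ a : ℝ≥0∞, (a ^ (1 / 2 : ℝ)) ^ 2 = a := fun a => by
    rw [← ENNReal.rpow_natCast, ← ENNReal.rpow_mul]; simp
  calc ∫⁻ x, (∫⁻ y, ‖k x y‖ₑ * f y ∂μ) ^ 2 ∂μ
      ≤ ∫⁻ x, ENNReal.ofReal N * ∫⁻ y, ‖k x y‖ₑ * f y ^ 2 ∂μ ∂μ := by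
        refine lintegral_mono fun x => ?_
        -- Cauchy–Schwarz for the splitting `|k| f = |k|^(1/2) · (|k|^(1/2) f)`.
        have h := lintegral_mul_sq_le (μ := μ) (f := fun y => ‖k x y‖ₑ ^ (1 / 2 : ℝ))
          (g := fun y => ‖k x y‖ₑ ^ (1 / 2 : ℝ) * f y)
          ((hkx x).pow_const _).aemeasurable (((hkx x).pow_const _).mul hf).aemeasurable
        simp only [← mul_assoc, ← pow_two, mul_pow, hsq] at h
        exact h.trans (mul_le_mul_left (h₁ x) _)
    _ = ENNReal.ofReal N * ∫⁻ y, ∫⁻ x, ‖k x y‖ₑ * f y ^ 2 ∂μ ∂μ := by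
        rw [lintegral_const_mul', lintegral_lintegral_swap]
        · exact (hk.enorm.mul ((hf.comp measurable_snd).pow_const 2)).aemeasurable
        · simp
    _ ≤ ENNReal.ofReal N * ∫⁻ y, ENNReal.ofReal N * f y ^ 2 ∂μ := by
        gcongr with y
        rw [lintegral_mul_const _ (hky y)]
        exact mul_le_mul_left (h₂ y) _
    _ = _ := by
        rw [lintegral_const_mul' _ _ (by simp), ← mul_assoc, pow_two]

theorem exists_isIntegralOperator_of_lintegral_sq {k : X → X → ℂ}
    (hk : Measurable (Function.uncurry k)) {D : ℝ} (hD : 0 ≤ D)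
    (h : ∫⁻ x, ∫⁻ y, ‖k x y‖ₑ ^ 2 ∂μ ∂μ ≤ ENNReal.ofReal D) :
    ∃ T : Lp ℂ 2 μ →L[ℂ] Lp ℂ 2 μ, IsIntegralOperator k T := by
  obtain ⟨T, -, hT⟩ := exists_isIntegralOperator (μ := μ) hk (Real.sqrt_nonneg D) fun f hf => by
    have hkx : ∀ x, Measurable fun y => ‖k x y‖ₑ := fun x => (hk.comp measurable_prodMk_left).enorm
    calc ∫⁻ x, (∫⁻ y, ‖k x y‖ₑ * f y ∂μ) ^ 2 ∂μ
        ≤ ∫⁻ x, (∫⁻ y, ‖k x y‖ₑ ^ 2 ∂μ) * ∫⁻ y, f y ^ 2 ∂μ ∂μ :=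
          lintegral_mono fun x => lintegral_mul_sq_le (hkx x).aemeasurable hf.aemeasurable
      _ = (∫⁻ x, ∫⁻ y, ‖k x y‖ₑ ^ 2 ∂μ ∂μ) * ∫⁻ y, f y ^ 2 ∂μ := by
          rw [lintegral_mul_const]
          exact Measurable.lintegral_prod_right (hk.enorm.pow_const 2)
      _ ≤ _ := by
          rw [← ENNReal.ofReal_pow (Real.sqrt_nonneg D), Real.sq_sqrt hD]
          exact mul_le_mul_left h _
  exact ⟨T, hT⟩

/-- For almost every `x`, `T e_i (x)` is the inner product of `e_i` with the conjugate of `k(x, ·)`.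
Bessel's inequality bounds the sum over `i` by `‖k(x, ·)‖²`, which is then integrated in `x`. -/
theorem IsIntegralOperator.hilbertSchmidtLE {k : X → X → ℂ} (hk : Measurable (Function.uncurry k))
    {D : ℝ} (hD : 0 ≤ D) (h : ∫⁻ x, ∫⁻ y, ‖k x y‖ₑ ^ 2 ∂μ ∂μ ≤ ENNReal.ofReal D)
    {T : Lp ℂ 2 μ →L[ℂ] Lp ℂ 2 μ} (hT : IsIntegralOperator k T) : HilbertSchmidtLE T D := by
  intro ι _ e he
  rw [← ENNReal.ofReal_le_ofReal_iff hD, ENNReal.ofReal_sum_of_nonneg fun i _ => by positivity]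
  simp_rw [ofReal_norm_Lp_two_sq]
  rw [← lintegral_finsetSum]
  swap
  · exact fun i _ => ((Lp.stronglyMeasurable (T (e i))).measurable.enorm.pow_const 2)
  refine le_trans (lintegral_mono_ae ?_) h
  have hfin : ∀ᵐ x ∂μ, ∫⁻ y, ‖k x y‖ₑ ^ 2 ∂μ < ∞ :=
    ae_lt_top (Measurable.lintegral_prod_right (hk.enorm.pow_const 2)) (h.trans_lt (by simp)).ne
  filter_upwards [hfin, ae_all_iff.2 fun i => hT (e i)] with x hx hTx
  have hmk : AEStronglyMeasurable (fun y => (starRingEnd ℂ) (k x y)) μ :=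
    (Complex.continuous_conj.measurable.comp
      (hk.comp measurable_prodMk_left)).aestronglyMeasurable
  have hmem : MemLp (fun y => (starRingEnd ℂ) (k x y)) 2 μ := by
    rw [memLp_two_iff_lintegral hmk]; simpa using hx
  set κ := hmem.toLp _
  have hκ : ENNReal.ofReal (‖κ‖ ^ 2) = ∫⁻ y, ‖k x y‖ₑ ^ 2 ∂μ := by
    rw [ofReal_norm_Lp_two_sq]
    refine lintegral_congr_ae ?_
    filter_upwards [hmem.coeFn_toLp] with y hy
    rw [hy]; simp
  have hTi : ∀ i, T (e i) x = inner ℂ κ (e i) := fun i => by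
    rw [(hTx i).2, L2.inner_def]
    refine integral_congr_ae ?_
    filter_upwards [hmem.coeFn_toLp] with y hy
    simp only [RCLike.inner_apply]
    rw [hy]; simp [mul_comm]
  have hB := he.sum_inner_products_le (s := Finset.univ) κ
  rw [← hκ]
  calc ∑ i, ‖T (e i) x‖ₑ ^ 2 = ENNReal.ofReal (∑ i, ‖inner ℂ (e i) κ‖ ^ 2) := by
        rw [ENNReal.ofReal_sum_of_nonneg fun i _ => by positivity]
        refine Finset.sum_congr rfl fun i _ => ?_
        rw [hTi, ← norm_inner_symm, ENNReal.ofReal_pow (norm_nonneg _), ofReal_norm]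
    _ ≤ _ := ENNReal.ofReal_le_ofReal hB

end IntegralOperators

/-! ### Pointwise bounds for the Biot–Savart kernel -/

section BiotSavart

theorem norm_perp (x : Plane) : ‖perp x‖ = ‖x‖ := by
  simp [perp, EuclideanSpace.norm_eq, add_comm]

theorem perp_smul (c : ℝ) (x : Plane) : perp (c • x) = c • perp x := by
  ext i; fin_cases i <;> simp [perp]

theorem perp_sub (x y : Plane) : perp (x - y) = perp x - perp y := by
  ext i; fin_cases i <;> simp [perp]; ring

theorem continuous_perp : Continuous perp := by
  unfold perp
  fun_prop

/-- Up to a constant and a quarter turn the kernel is the inversion `x / |x|²`, whose distances are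
known exactly: `|x - y| / (|x| |y|)`. This yields the difference bound below. -/
theorem biotSavartKernel_eq (x : Plane) :
    biotSavartKernel x = (1 / (2 * Real.pi)) • perp ((1 / ‖x‖) ^ 2 • x) := by
  rw [perp_smul, smul_smul, biotSavartKernel]
  congr 1
  ring

theorem measurable_biotSavartKernel : Measurable biotSavartKernel := by
  unfold biotSavartKernel
  have := continuous_perp.measurable
  fun_prop

theorem norm_biotSavartKernel_le (x : Plane) : ‖biotSavartKernel x‖ ≤ ‖x‖⁻¹ / 6 := by
  rw [biotSavartKernel_eq, norm_smul, norm_perp, norm_smul]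
  rcases eq_or_ne x 0 with h | h
  · simp [h]
  have hx : 0 < ‖x‖ := norm_pos_iff.2 h
  have h1 : ‖(1 / ‖x‖) ^ 2‖ * ‖x‖ = ‖x‖⁻¹ := by
    rw [Real.norm_of_nonneg (by positivity)]; field_simp
  have h2 : ‖1 / (2 * Real.pi)‖ ≤ 1 / 6 := by
    rw [Real.norm_of_nonneg (by positivity)]
    exact one_div_le_one_div_of_le (by norm_num) (by linarith [Real.pi_gt_three])
  rw [h1]
  calc _ ≤ 1 / 6 * ‖x‖⁻¹ := mul_le_mul_of_nonneg_right h2 (by positivity)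
    _ = _ := by ring

theorem norm_biotSavartKernel_sub_le {x y : Plane} (hx : x ≠ 0) (hy : y ≠ 0) :
    ‖biotSavartKernel x - biotSavartKernel y‖ ≤ ‖x - y‖ / (‖x‖ * ‖y‖) / 6 := by
  have h := dist_div_norm_sq_smul hx hy 1
  rw [biotSavartKernel_eq, biotSavartKernel_eq, ← smul_sub, ← perp_sub, norm_smul, norm_perp,
    ← dist_eq_norm, h]
  have h2 : ‖1 / (2 * Real.pi)‖ ≤ 1 / 6 := by
    rw [Real.norm_of_nonneg (by positivity)]
    exact one_div_le_one_div_of_le (by norm_num) (by linarith [Real.pi_gt_three])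
  calc _ ≤ 1 / 6 * (1 ^ 2 / (‖x‖ * ‖y‖) * dist x y) := mul_le_mul_of_nonneg_right h2 (by positivity)
    _ = _ := by rw [dist_eq_norm]; ring

/-- An integrable majorant comparable to `|z|^(δ-2)` at the origin and `|z|^(-δ-2)` at infinity. -/
noncomputable def radialWeight (δ : ℝ) (z : Plane) : ℝ := ‖z‖ ^ (δ - 2) * (1 + ‖z‖) ^ (-2 * δ)

theorem radialWeight_nonneg (δ : ℝ) (z : Plane) : 0 ≤ radialWeight δ z := by
  unfold radialWeight; positivity

theorem integrable_radialWeight {δ : ℝ} (hδ : 0 < δ) : Integrable (radialWeight δ) := by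
  have h := (integrable_fun_norm_addHaar (volume : Measure Plane)
    (f := fun r : ℝ => r ^ (δ - 2) * (1 + r) ^ (-2 * δ))).2
  refine h ?_
  have hd : Module.finrank ℝ Plane - 1 = 1 := by simp
  rw [hd]
  have hcongr : ∀ y ∈ Set.Ioi (0 : ℝ), y ^ 1 • (y ^ (δ - 2) * (1 + y) ^ (-2 * δ)) =
      y ^ (δ - 1) * (1 + y) ^ (-2 * δ) := fun y hy => by
    have hy' : (0 : ℝ) < y := hy
    rw [smul_eq_mul, ← mul_assoc, pow_one]
    congr 1
    nth_rw 1 [← Real.rpow_one y]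
    rw [← Real.rpow_add hy']
    congr 1; ring
  rw [integrableOn_congr_fun hcongr measurableSet_Ioi, ← Set.Ioc_union_Ioi_eq_Ioi zero_le_one]
  have hmeas : Measurable fun y : ℝ => y ^ (δ - 1) * (1 + y) ^ (-2 * δ) := by fun_prop
  refine IntegrableOn.union ?_ ?_
  · have h1 : IntegrableOn (fun y : ℝ => y ^ (δ - 1)) (Set.Ioc 0 1) :=
      (intervalIntegrable_iff_integrableOn_Ioc_of_le zero_le_one).1
        (intervalIntegral.intervalIntegrable_rpow' (by linarith))
    refine h1.mono' hmeas.aestronglyMeasurable ?_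
    refine (ae_restrict_iff' measurableSet_Ioc).2 (.of_forall fun y hy => ?_)
    have hy0 : 0 < y := hy.1
    rw [Real.norm_of_nonneg (by positivity)]
    exact mul_le_of_le_one_right (by positivity)
      (Real.rpow_le_one_of_one_le_of_nonpos (by linarith) (by linarith))
  · have h1 : IntegrableOn (fun y : ℝ => y ^ (-δ - 1)) (Set.Ioi 1) :=
      integrableOn_Ioi_rpow_of_lt (by linarith) one_pos
    refine h1.mono' hmeas.aestronglyMeasurable ?_
    refine (ae_restrict_iff' measurableSet_Ioi).2 (.of_forall fun y hy => ?_)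
    have hy1 : 1 < y := hy
    have hy0 : 0 < y := by linarith
    rw [Real.norm_of_nonneg (by positivity)]
    calc y ^ (δ - 1) * (1 + y) ^ (-2 * δ) ≤ y ^ (δ - 1) * y ^ (-2 * δ) :=
          mul_le_mul_of_nonneg_left
            (Real.rpow_le_rpow_of_nonpos hy0 (by linarith) (by linarith)) (by positivity)
      _ = y ^ (-δ - 1) := by rw [← Real.rpow_add hy0]; congr 1; ring

/-- The function `|z|^(-2)` is not integrable at either end. It equals `((1 + r)² / r)^δ` times the
integrable weight, with `r = |z|`, and the first factor is at most `(4L / a)^δ` on the annulus. -/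
theorem inv_norm_sq_le_radialWeight {δ a L : ℝ} (hδ : 0 ≤ δ) (ha : 0 < a) (ha1 : a ≤ 1)
    (hL : 1 ≤ L) {z : Plane} (haz : a ≤ ‖z‖) (hzL : ‖z‖ ≤ L) :
    (‖z‖⁻¹) ^ 2 ≤ (4 * L / a) ^ δ * radialWeight δ z := by
  unfold radialWeight
  set r := ‖z‖
  have hr : 0 < r := ha.trans_le haz
  have h1 : (r⁻¹) ^ 2 = ((1 + r) ^ 2 / r) ^ δ * (r ^ (δ - 2) * (1 + r) ^ (-2 * δ)) := by
    have h2 : ((1 + r) ^ 2) ^ δ * (1 + r) ^ (-2 * δ) = 1 := by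
      rw [← Real.rpow_natCast, ← Real.rpow_mul (by positivity), ← Real.rpow_add (by positivity)]
      simp
    have h3 : r ^ (δ - 2) = r ^ δ * (r⁻¹) ^ 2 := by
      rw [Real.rpow_sub hr, Real.rpow_two, inv_pow]; rfl
    rw [Real.div_rpow (by positivity) hr.le, h3]
    have h4 : r ^ δ ≠ 0 := (Real.rpow_pos_of_pos hr δ).ne'
    calc (r⁻¹) ^ 2 = (((1 + r) ^ 2) ^ δ * (1 + r) ^ (-2 * δ)) * (r ^ δ / r ^ δ) * (r⁻¹) ^ 2 := by
          rw [h2, div_self h4]; ring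
      _ = _ := by ring
  rw [h1]
  refine mul_le_mul_of_nonneg_right (Real.rpow_le_rpow (by positivity) ?_ hδ) (by positivity)
  rw [div_le_div_iff₀ hr ha]
  rcases le_total r 1 with h | h
  · nlinarith [mul_le_mul_of_nonneg_left haz (by linarith : (0 : ℝ) ≤ L),
      mul_le_mul_of_nonneg_left haz (by linarith : (0 : ℝ) ≤ r)]
  · have : (1 + r) ^ 2 * a ≤ (1 + r) ^ 2 := mul_le_of_le_one_right (by positivity) ha1
    nlinarith

/-- The Biot–Savart kernel, cut off on the diagonal and renormalised at infinity. -/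
noncomputable def farKernel (ε : ℝ) (x y : Plane) : Plane :=
  (if ε ≤ ‖x - y‖ then biotSavartKernel (x - y) else 0) -
    if 1 ≤ ‖y‖ then biotSavartKernel (-y) else 0

theorem norm_sub_sq_le (a b : Plane) : ‖a - b‖ ^ 2 ≤ 2 * ‖a‖ ^ 2 + 2 * ‖b‖ ^ 2 := by
  have h := norm_sub_le a b
  nlinarith [norm_nonneg (a - b), sq_nonneg (‖a‖ - ‖b‖)]

/-- For `|y|` large compared with `1 + |x|` the two terms cancel to order `|x| / |y|²`; otherwise
`y` and `x - y` are `O(1 + |x|)` and each term is compared with the weight separately. -/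
theorem norm_farKernel_sq_le {δ ε : ℝ} (hδ : 0 ≤ δ) (hδ2 : δ ≤ 2) (hε : 0 < ε) (hε1 : ε ≤ 1)
    (x y : Plane) : ‖farKernel ε x y‖ ^ 2 ≤
      (12 * (1 + ‖x‖) / ε) ^ δ * (radialWeight δ (x - y) + radialWeight δ y) := by
  have hw := radialWeight_nonneg δ
  have hx0 := norm_nonneg x
  -- Beyond this threshold `|y| ≥ 1` and `|x - y| ≥ |y| / 2 ≥ 1 ≥ ε`, so neither cutoff is active.
  by_cases hfar : 2 * (1 + ‖x‖) ≤ ‖y‖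
  · have hy1 : 1 ≤ ‖y‖ := by linarith
    have hxy : ‖y‖ / 2 ≤ ‖x - y‖ := by
      have := norm_sub_norm_le y x
      rw [norm_sub_rev] at this; linarith
    have hxy0 : 0 < ‖x - y‖ := by linarith
    rw [farKernel, if_pos (by linarith), if_pos hy1]
    have h1 := norm_biotSavartKernel_sub_le (norm_pos_iff.1 hxy0)
      (show -y ≠ 0 by rw [neg_ne_zero]; rw [← norm_pos_iff]; linarith)
    rw [sub_neg_eq_add, sub_add_cancel, norm_neg] at h1
    have h2 : ‖biotSavartKernel (x - y) - biotSavartKernel (-y)‖ ≤ ‖x‖ * (‖y‖⁻¹) ^ 2 := by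
      refine h1.trans ?_
      rw [div_div, div_le_iff₀ (by positivity)]
      have : ‖x‖ * (‖y‖⁻¹) ^ 2 * (‖x - y‖ * ‖y‖ * 6) = ‖x‖ * ((‖x - y‖ * 6) / ‖y‖) := by
        field_simp
      rw [this]
      refine le_mul_of_one_le_right hx0 ?_
      rw [le_div_iff₀ (by linarith)]; linarith
    have h3 := inv_norm_sq_le_radialWeight hδ one_pos le_rfl hy1 hy1 le_rfl
    -- The ratio is at most `1` and `δ ≤ 2`, so the square may be weakened to the power `δ`; this
    -- absorbs the growth `|y|^δ` coming from the weight.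
    have h4 : ‖x‖ ^ 2 * (‖y‖⁻¹) ^ 2 ≤ (‖x‖ / ‖y‖) ^ δ := by
      rw [← mul_pow, ← div_eq_mul_inv, ← Real.rpow_two]
      rcases eq_or_lt_of_le hx0 with h0 | h0
      · rw [← h0]; simp; exact Real.rpow_nonneg le_rfl _
      · exact Real.rpow_le_rpow_of_exponent_ge (by positivity)
          ((div_le_one (by linarith)).2 (by linarith)) hδ2
    calc _ ≤ (‖x‖ * (‖y‖⁻¹) ^ 2) ^ 2 := pow_le_pow_left₀ (norm_nonneg _) h2 2
      _ = (‖x‖ ^ 2 * (‖y‖⁻¹) ^ 2) * (‖y‖⁻¹) ^ 2 := by ring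
      _ ≤ (‖x‖ / ‖y‖) ^ δ * ((4 * ‖y‖ / 1) ^ δ * radialWeight δ y) :=
          mul_le_mul h4 h3 (by positivity) (by positivity)
      _ = (4 * ‖x‖) ^ δ * radialWeight δ y := by
          rw [← mul_assoc, ← Real.mul_rpow (by positivity) (by positivity)]
          congr 2; field_simp
      _ ≤ (12 * (1 + ‖x‖) / ε) ^ δ * radialWeight δ y := by
          refine mul_le_mul_of_nonneg_right (Real.rpow_le_rpow (by positivity) ?_ hδ) (hw _)
          rw [le_div_iff₀ hε]; nlinarith
      _ ≤ _ := mul_le_mul_of_nonneg_left (by linarith [hw (x - y)]) (by positivity)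
  · push Not at hfar
    have hxy : ‖x - y‖ ≤ 3 * (1 + ‖x‖) := by linarith [norm_sub_le x y]
    have h1 : ‖if ε ≤ ‖x - y‖ then biotSavartKernel (x - y) else 0‖ ^ 2 ≤
        (12 * (1 + ‖x‖) / ε) ^ δ * radialWeight δ (x - y) / 36 := by
      split_ifs with h
      · have h3 := inv_norm_sq_le_radialWeight hδ hε hε1
          (by linarith : 1 ≤ 3 * (1 + ‖x‖)) h hxy
        have h2 := pow_le_pow_left₀ (norm_nonneg _) (norm_biotSavartKernel_le (x - y)) 2
        have h4 : 4 * (3 * (1 + ‖x‖)) = 12 * (1 + ‖x‖) := by ring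
        rw [h4] at h3
        rw [div_pow] at h2
        linarith
      · have := hw (x - y)
        simp only [norm_zero, ne_eq, OfNat.ofNat_ne_zero, not_false_eq_true, zero_pow]
        positivity
    have h2 : ‖if 1 ≤ ‖y‖ then biotSavartKernel (-y) else 0‖ ^ 2 ≤
        (12 * (1 + ‖x‖) / ε) ^ δ * radialWeight δ y / 36 := by
      split_ifs with h
      · have h3 := inv_norm_sq_le_radialWeight hδ one_pos le_rfl
          (by linarith : 1 ≤ 2 * (1 + ‖x‖)) h hfar.le
        have h2 := pow_le_pow_left₀ (norm_nonneg _) (norm_biotSavartKernel_le (-y)) 2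
        have h4 : (4 * (2 * (1 + ‖x‖)) / 1) ^ δ ≤ (12 * (1 + ‖x‖) / ε) ^ δ := by
          refine Real.rpow_le_rpow (by positivity) ?_ hδ
          rw [le_div_iff₀ hε]; nlinarith
        have h5 := mul_le_mul_of_nonneg_right h4 (hw y)
        rw [div_pow, norm_neg] at h2
        linarith
      · have := hw y
        simp only [norm_zero, ne_eq, OfNat.ofNat_ne_zero, not_false_eq_true, zero_pow]
        positivity
    have h3 := norm_sub_sq_le (if ε ≤ ‖x - y‖ then biotSavartKernel (x - y) else 0)
      (if 1 ≤ ‖y‖ then biotSavartKernel (-y) else 0)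
    rw [← farKernel] at h3
    have h4 : 0 ≤ (12 * (1 + ‖x‖) / ε) ^ δ * radialWeight δ (x - y) :=
      mul_nonneg (by positivity) (hw _)
    have h5 : 0 ≤ (12 * (1 + ‖x‖) / ε) ^ δ * radialWeight δ y :=
      mul_nonneg (by positivity) (hw _)
    rw [mul_add]
    linarith

/-- The part of the Biot–Savart kernel near the origin. -/
noncomputable def nearKernel (ε : ℝ) (z : Plane) : Plane := if ‖z‖ < ε then biotSavartKernel z else 0

theorem norm_nearKernel_le {ε : ℝ} (hε1 : ε ≤ 1) (z : Plane) :
    ‖nearKernel ε z‖ ≤ Real.sqrt ε * radialWeight (1 / 2) z := by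
  unfold nearKernel
  split_ifs with h
  · refine (norm_biotSavartKernel_le z).trans ?_
    rcases eq_or_ne z 0 with h0 | h0
    · simp only [h0, norm_zero, inv_zero, zero_div]
      exact mul_nonneg (Real.sqrt_nonneg _) (radialWeight_nonneg _ _)
    have hz : 0 < ‖z‖ := norm_pos_iff.2 h0
    unfold radialWeight
    have e1 : (1 + ‖z‖) ^ (-2 * (1 / 2) : ℝ) = (1 + ‖z‖)⁻¹ := by
      rw [show (-2 * (1 / 2) : ℝ) = -1 by norm_num, Real.rpow_neg_one]
    have e2 : ‖z‖ ^ (1 / 2 - 2 : ℝ) = (Real.sqrt ‖z‖)⁻¹ * ‖z‖⁻¹ := by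
      rw [Real.sqrt_eq_rpow, ← Real.rpow_neg_one ‖z‖, ← Real.rpow_neg hz.le, ← Real.rpow_add hz]
      norm_num
    rw [e1, e2]
    -- The gain `√ε`: half a power of `|z|` is traded for it, and `|z|^(-3/2)` is still integrable
    -- at the origin.
    have h1 : 1 ≤ Real.sqrt ε * (Real.sqrt ‖z‖)⁻¹ := by
      rw [← div_eq_mul_inv, one_le_div (Real.sqrt_pos.2 hz)]
      exact Real.sqrt_le_sqrt h.le
    have h2 : (1 / 6 : ℝ) ≤ (1 + ‖z‖)⁻¹ := by
      rw [← one_div]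
      exact one_div_le_one_div_of_le (by positivity) (by linarith)
    calc ‖z‖⁻¹ / 6 = 1 * ‖z‖⁻¹ * (1 / 6) := by ring
      _ ≤ Real.sqrt ε * (Real.sqrt ‖z‖)⁻¹ * ‖z‖⁻¹ * (1 + ‖z‖)⁻¹ := by gcongr
      _ = _ := by ring
  · simp only [norm_zero]
    exact mul_nonneg (Real.sqrt_nonneg _) (radialWeight_nonneg _ _)

end BiotSavart

/-! ### Sums and uniqueness of integral operators -/

section IntegralOperatorAlgebra

variable {X : Type*} [MeasurableSpace X] {μ : Measure X}

theorem IsIntegralOperator.add {k k' : X → X → ℂ} {T T' : Lp ℂ 2 μ →L[ℂ] Lp ℂ 2 μ}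
    (h : IsIntegralOperator k T) (h' : IsIntegralOperator k' T') :
    IsIntegralOperator (fun x y => k x y + k' x y) (T + T') := by
  intro ω
  filter_upwards [h ω, h' ω, Lp.coeFn_add (T ω) (T' ω)] with x h1 h2 h3
  have h4 : (fun y => (k x y + k' x y) * ω y) = fun y => k x y * ω y + k' x y * ω y := by
    funext y; ring
  rw [h4]
  refine ⟨h1.1.add h2.1, ?_⟩
  rw [add_apply, h3, Pi.add_apply, h1.2, h2.2, ← integral_add h1.1 h2.1]

theorem IsIntegralOperator.unique {k : X → X → ℂ} {T T' : Lp ℂ 2 μ →L[ℂ] Lp ℂ 2 μ}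
    (h : IsIntegralOperator k T) (h' : IsIntegralOperator k T') : T = T' := by
  ext1 ω
  apply Lp.ext
  filter_upwards [h ω, h' ω] with x h1 h2
  rw [h1.2, h2.2]

end IntegralOperatorAlgebra

/-! ### The operator on `L²` and its Hilbert–Schmidt approximations -/

section StretchOperator

open scoped ENNReal

variable {g : Plane → Plane →L[ℝ] ℝ} {G a : ℝ}

/-- The kernel `(x, y) ↦ (g(x), k(x, y))`. -/
def pairKernel (g : Plane → Plane →L[ℝ] ℝ) (k : Plane → Plane → Plane) (x y : Plane) : ℂ :=
  ((g x (k x y) : ℝ) : ℂ)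

theorem enorm_pairKernel_le (g : Plane → Plane →L[ℝ] ℝ) (k : Plane → Plane → Plane)
    (x y : Plane) {c : ℝ} (hc : ‖g x‖ * ‖k x y‖ ≤ c) : ‖pairKernel g k x y‖ₑ ≤ ENNReal.ofReal c := by
  rw [← ofReal_norm]
  refine ENNReal.ofReal_le_ofReal (le_trans ?_ hc)
  rw [pairKernel, Complex.norm_real]
  exact (g x).le_opNorm _

theorem measurable_pairKernel (hg : Continuous g) {k : Plane → Plane → Plane}
    (hk : Measurable (Function.uncurry k)) : Measurable (Function.uncurry (pairKernel g k)) := by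
  refine Complex.measurable_ofReal.comp ?_
  have h : (fun p : Plane × Plane => g p.1 (Function.uncurry k p)) =
      (fun q : (Plane →L[ℝ] ℝ) × Plane => q.1 q.2) ∘ fun p => (g p.1, Function.uncurry k p) := rfl
  have hc : Continuous fun q : (Plane →L[ℝ] ℝ) × Plane => q.1 q.2 :=
    isBoundedBilinearMap_apply.continuous
  exact hc.measurable.comp ((hg.measurable.comp measurable_fst).prodMk hk)

theorem measurable_farKernel (ε : ℝ) : Measurable (Function.uncurry (farKernel ε)) := by
  have h := measurable_biotSavartKernel
  unfold farKernel Function.uncurry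
  refine Measurable.sub (Measurable.ite ?_ (by fun_prop) measurable_const)
    (Measurable.ite ?_ (by fun_prop) measurable_const)
  · exact measurableSet_le measurable_const (by fun_prop)
  · exact measurableSet_le measurable_const (by fun_prop)

theorem measurable_nearKernel (ε : ℝ) : Measurable (nearKernel ε) := by
  unfold nearKernel
  exact Measurable.ite (measurableSet_lt (by fun_prop) measurable_const)
    measurable_biotSavartKernel measurable_const

theorem integrable_one_add_norm_rpow {r : ℝ} (hr : r < -2) :
    Integrable fun x : Plane => (1 + ‖x‖) ^ r := by
  have h := integrable_one_add_norm (E := Plane) (μ := volume) (r := -r) (by simp; linarith)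
  simpa using h

/-- The majorant depends only on `x - y` and is integrable, so both Schur integrals are the same
translate-invariant constant. -/
theorem exists_nearOperator (hg : Continuous g) (hG : 0 ≤ G) (hgG : ∀ x, ‖g x‖ ≤ G) :
    ∃ K : ℝ, 0 ≤ K ∧ ∀ ε : ℝ, 0 < ε → ε ≤ 1 → ∃ T : L2 →L[ℂ] L2, ‖T‖ ≤ K * Real.sqrt ε ∧
      IsIntegralOperator (pairKernel g fun x y => nearKernel ε (x - y)) T := by
  have hw0 := radialWeight_nonneg (1 / 2)
  have hwi := integrable_radialWeight (δ := 1 / 2) (by norm_num)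
  set I := ∫ z, radialWeight (1 / 2) z
  have hI : 0 ≤ I := integral_nonneg hw0
  have hIl : ∫⁻ z, ENNReal.ofReal (radialWeight (1 / 2) z) = ENNReal.ofReal I :=
    (ofReal_integral_eq_lintegral_ofReal hwi (.of_forall hw0)).symm
  refine ⟨G * I, by positivity, fun ε hε hε1 => ?_⟩
  have hpt : ∀ x y, ‖pairKernel g (fun x y => nearKernel ε (x - y)) x y‖ₑ ≤
      ENNReal.ofReal (G * Real.sqrt ε) * ENNReal.ofReal (radialWeight (1 / 2) (x - y)) := by
    intro x y
    rw [← ENNReal.ofReal_mul (by positivity)]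
    refine enorm_pairKernel_le g _ x y ?_
    calc ‖g x‖ * ‖nearKernel ε (x - y)‖ ≤ G * (Real.sqrt ε * radialWeight (1 / 2) (x - y)) :=
          mul_le_mul (hgG x) (norm_nearKernel_le hε1 _) (norm_nonneg _) hG
      _ = _ := by ring
  have hC : ENNReal.ofReal (G * Real.sqrt ε) * ENNReal.ofReal I =
      ENNReal.ofReal (G * I * Real.sqrt ε) := by
    rw [← ENNReal.ofReal_mul (by positivity)]; congr 1; ring
  have hkm : Measurable (Function.uncurry fun x y : Plane => nearKernel ε (x - y)) :=
    (measurable_nearKernel ε).comp (measurable_fst.sub measurable_snd)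
  refine exists_isIntegralOperator_of_schur (measurable_pairKernel hg hkm) (by positivity) (fun x => ?_) fun y => ?_
  · refine (lintegral_mono fun y => hpt x y).trans_eq ?_
    rw [lintegral_const_mul' _ _ (by simp),
      lintegral_sub_left_eq_self (fun z => ENNReal.ofReal (radialWeight (1 / 2) z)), hIl, hC]
  · refine (lintegral_mono fun x => hpt x y).trans_eq ?_
    rw [lintegral_const_mul' _ _ (by simp),
      lintegral_sub_right_eq_self (fun z => ENNReal.ofReal (radialWeight (1 / 2) z)), hIl, hC]

/-- The `y`-integral of the squared kernel grows at most like `(1 + |x|)^δ`, while `|g|²` decays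
like `(1 + |x|)^(-2-2a)`. The product is integrable over the plane because `δ < 2a`. -/
theorem lintegral_sq_farKernel_le (hgG : ∀ x, ‖g x‖ ≤ G * (1 + ‖x‖) ^ (-1 - a))
    {δ : ℝ} (hδ : 0 < δ) (hδ2 : δ ≤ 2) (hδa : δ < 2 * a) :
    ∃ D : ℝ, 0 ≤ D ∧ ∀ ε : ℝ, 0 < ε → ε ≤ 1 →
      ∫⁻ x, ∫⁻ y, ‖pairKernel g (farKernel ε) x y‖ₑ ^ 2 ≤ ENNReal.ofReal (D * ε ^ (-δ)) := by
  have hw0 := radialWeight_nonneg δ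
  have hwi := integrable_radialWeight hδ
  set I := ∫ z, radialWeight δ z
  have hI : 0 ≤ I := integral_nonneg hw0
  have hIl : ∫⁻ z, ENNReal.ofReal (radialWeight δ z) = ENNReal.ofReal I :=
    (ofReal_integral_eq_lintegral_ofReal hwi (.of_forall hw0)).symm
  have hwm : ∀ x, AEMeasurable fun y => ENNReal.ofReal (radialWeight δ (x - y)) := fun x =>
    (hwi.comp_sub_left x).aemeasurable.ennreal_ofReal
  have hJi := integrable_one_add_norm_rpow (r := -2 - 2 * a + δ) (by linarith)
  set J := ∫ x : Plane, (1 + ‖x‖) ^ (-2 - 2 * a + δ)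
  have hJ0 : ∀ x : Plane, 0 ≤ (1 + ‖x‖) ^ (-2 - 2 * a + δ) := fun x => by positivity
  have hJ : 0 ≤ J := integral_nonneg hJ0
  have hJl : ∫⁻ x : Plane, ENNReal.ofReal ((1 + ‖x‖) ^ (-2 - 2 * a + δ)) = ENNReal.ofReal J :=
    (ofReal_integral_eq_lintegral_ofReal hJi (.of_forall hJ0)).symm
  refine ⟨G ^ 2 * 12 ^ δ * J * (2 * I), by positivity, fun ε hε hε1 => ?_⟩
  set c : ℝ := G ^ 2 * 12 ^ δ * ε ^ (-δ)
  have hc : 0 ≤ c := by positivity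
  have hpt : ∀ x y, ‖pairKernel g (farKernel ε) x y‖ₑ ^ 2 ≤
      ENNReal.ofReal (c * (1 + ‖x‖) ^ (-2 - 2 * a + δ)) *
        (ENNReal.ofReal (radialWeight δ (x - y)) + ENNReal.ofReal (radialWeight δ y)) := by
    intro x y
    rw [← ENNReal.ofReal_add (hw0 _) (hw0 _), ← ENNReal.ofReal_mul (by positivity)]
    refine (pow_le_pow_left' (enorm_pairKernel_le g _ x y le_rfl) 2).trans ?_
    rw [← ENNReal.ofReal_pow (by positivity)]
    refine ENNReal.ofReal_le_ofReal ?_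
    have hx : 0 < 1 + ‖x‖ := by positivity
    have h1 := pow_le_pow_left₀ (norm_nonneg _) (hgG x) 2
    have h2 := norm_farKernel_sq_le hδ.le hδ2 hε hε1 x y
    rw [mul_pow]
    refine (mul_le_mul h1 h2 (by positivity) (by positivity)).trans_eq ?_
    rw [← mul_assoc]
    congr 1
    rw [Real.div_rpow (by positivity) hε.le, Real.mul_rpow (by norm_num) hx.le, mul_pow,
      ← Real.rpow_natCast ((1 + ‖x‖) ^ (-1 - a)), ← Real.rpow_mul hx.le, Real.rpow_add hx]
    simp only [c]
    rw [Real.rpow_neg hε.le, div_eq_mul_inv, show (-1 - a) * ((2 : ℕ) : ℝ) = -2 - 2 * a by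
      push_cast; ring]
    ring
  have hin : ∀ x, ∫⁻ y, ‖pairKernel g (farKernel ε) x y‖ₑ ^ 2 ≤
      ENNReal.ofReal (c * (2 * I)) * ENNReal.ofReal ((1 + ‖x‖) ^ (-2 - 2 * a + δ)) := fun x => by
    refine (lintegral_mono fun y => hpt x y).trans_eq ?_
    rw [lintegral_const_mul' _ _ (by simp), lintegral_add_left' (hwm x),
      lintegral_sub_left_eq_self (fun z => ENNReal.ofReal (radialWeight δ z)), hIl,
      ← ENNReal.ofReal_add hI hI, ← ENNReal.ofReal_mul (by positivity),
      ← ENNReal.ofReal_mul (by positivity)]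
    congr 1; ring
  refine (lintegral_mono hin).trans_eq ?_
  rw [lintegral_const_mul' _ _ (by simp), hJl, ← ENNReal.ofReal_mul (by positivity)]
  congr 1
  simp only [c]; ring

/-- The kernel `(x, y) ↦ 𝒦(x - y)`, renormalised at infinity. -/
noncomputable def renormalizedKernel (x y : Plane) : Plane :=
  biotSavartKernel (x - y) - if 1 ≤ ‖y‖ then biotSavartKernel (-y) else 0

theorem farKernel_add_nearKernel (ε : ℝ) (x y : Plane) :
    farKernel ε x y + nearKernel ε (x - y) = renormalizedKernel x y := by
  unfold farKernel nearKernel renormalizedKernel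
  rcases le_or_gt ε ‖x - y‖ with h | h
  · rw [if_pos h, if_neg (not_lt.2 h), add_zero]
  · rw [if_neg (not_le.2 h), if_pos h]; abel

/-- The cut at `ε = t²` turns the near norm `√ε` into `t`; the far estimate is used with exponent `δ
/ 2`, so that `ε^(-δ/2) = t^(-δ)`. Since the kernel determines the operator, every cut decomposes
the same `T`. -/
theorem exists_stretchOperator (hg : Continuous g) (ha : 0 < a) (hG : 0 ≤ G)
    (hgG : ∀ x, ‖g x‖ ≤ G * (1 + ‖x‖) ^ (-1 - a)) :
    ∃ T : L2 →L[ℂ] L2, IsIntegralOperator (pairKernel g renormalizedKernel) T ∧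
      ∀ δ : ℝ, 0 < δ → δ ≤ 4 → δ < 4 * a → ∃ K D : ℝ, ∀ t : ℝ, 0 < t → t ≤ 1 →
        ∃ B : L2 →L[ℂ] L2, ‖T - B‖ ≤ K * t ∧ HilbertSchmidtLE B (D * t ^ (-δ)) := by
  have hgG' : ∀ x, ‖g x‖ ≤ G := fun x => (hgG x).trans <| mul_le_of_le_one_right hG <|
    Real.rpow_le_one_of_one_le_of_nonpos (by linarith [norm_nonneg x]) (by linarith)
  obtain ⟨K, hK, hnear⟩ := exists_nearOperator hg hG hgG'
  have hsum : ∀ ε : ℝ, (fun x y => pairKernel g (farKernel ε) x y +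
      pairKernel g (fun x y => nearKernel ε (x - y)) x y) = pairKernel g renormalizedKernel := by
    intro ε; funext x y
    simp only [pairKernel]
    rw [← farKernel_add_nearKernel ε, map_add, Complex.ofReal_add]
  have hfar : ∀ δ : ℝ, 0 < δ → δ ≤ 4 → δ < 4 * a → ∃ D : ℝ, ∀ t : ℝ, 0 < t → t ≤ 1 →
      ∃ B : L2 →L[ℂ] L2, IsIntegralOperator (pairKernel g (farKernel (t ^ 2))) B ∧
        HilbertSchmidtLE B (D * t ^ (-δ)) := by
    intro δ hδ hδ4 hδa
    obtain ⟨D, hD, h⟩ := lintegral_sq_farKernel_le hgG (half_pos hδ) (by linarith)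
      (by linarith : δ / 2 < 2 * a)
    refine ⟨D, fun t ht ht1 => ?_⟩
    have h1 := h (t ^ 2) (by positivity) (pow_le_one₀ ht.le ht1)
    have h2 : (t ^ 2) ^ (-(δ / 2)) = t ^ (-δ) := by
      rw [← Real.rpow_natCast, ← Real.rpow_mul ht.le]; congr 1; push_cast; ring
    rw [h2] at h1
    have hm := measurable_pairKernel hg (measurable_farKernel (t ^ 2))
    obtain ⟨B, hB⟩ := exists_isIntegralOperator_of_lintegral_sq hm (by positivity) h1
    exact ⟨B, hB, hB.hilbertSchmidtLE hm (by positivity) h1⟩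
  -- The operator is built once, from the cut at `ε = 1`; any admissible exponent would do here.
  obtain ⟨D₁, h₁⟩ := hfar (min 4 (2 * a)) (by positivity) (min_le_left _ _)
    ((min_le_right _ _).trans_lt (by linarith))
  obtain ⟨B₁, hB₁, -⟩ := h₁ 1 one_pos le_rfl
  obtain ⟨R₁, -, hR₁⟩ := hnear (1 ^ 2) (by norm_num) (by norm_num)
  have hT := hB₁.add hR₁
  rw [hsum] at hT
  refine ⟨B₁ + R₁, hT, fun δ hδ hδ4 hδa => ?_⟩
  obtain ⟨D, hD⟩ := hfar δ hδ hδ4 hδa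
  refine ⟨K, D, fun t ht ht1 => ?_⟩
  obtain ⟨B, hB, hBD⟩ := hD t ht ht1
  obtain ⟨R, hRn, hR⟩ := hnear (t ^ 2) (by positivity) (pow_le_one₀ ht.le ht1)
  have hT' := hB.add hR
  rw [hsum] at hT'
  refine ⟨B, ?_, hBD⟩
  rw [hT.unique hT', add_sub_cancel_left]
  rwa [Real.sqrt_sq ht.le] at hRn

end StretchOperator

/-! ### Rotation covariance -/

section Rotation

theorem planeRotation_apply_zero (θ : ℝ) (x : Plane) :
    planeRotation θ x 0 = Real.cos θ * x 0 - Real.sin θ * x 1 := by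
  simp [planeRotation]

theorem planeRotation_apply_one (θ : ℝ) (x : Plane) :
    planeRotation θ x 1 = Real.sin θ * x 0 + Real.cos θ * x 1 := by
  simp [planeRotation]

theorem perp_planeRotation (θ : ℝ) (x : Plane) :
    perp (planeRotation θ x) = planeRotation θ (perp x) := by
  ext i; fin_cases i <;> simp [perp, planeRotation] <;> ring

theorem biotSavartKernel_planeRotation (θ : ℝ) (x : Plane) :
    biotSavartKernel (planeRotation θ x) = planeRotation θ (biotSavartKernel x) := by
  rw [biotSavartKernel, biotSavartKernel, perp_planeRotation, LinearIsometry.norm_map,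
    LinearIsometry.map_smul]

theorem renormalizedKernel_planeRotation (θ : ℝ) (x y : Plane) :
    renormalizedKernel (planeRotation θ x) (planeRotation θ y) =
      planeRotation θ (renormalizedKernel x y) := by
  unfold renormalizedKernel
  rw [← map_sub, ← map_neg, LinearIsometry.norm_map, biotSavartKernel_planeRotation,
    biotSavartKernel_planeRotation, map_sub]
  split_ifs <;> simp

theorem fderiv_planeRotation {φ : Plane → ℝ} {θ : ℝ} (hφ : Differentiable ℝ φ)
    (hinv : ∀ x, φ (planeRotation θ x) = φ x) (x v : Plane) :
    fderiv ℝ φ (planeRotation θ x) (planeRotation θ v) = fderiv ℝ φ x v := by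
  have h1 : HasFDerivAt (φ ∘ planeRotation θ)
      ((fderiv ℝ φ (planeRotation θ x)).comp (planeRotation θ).toContinuousLinearMap) x :=
    (hφ _).hasFDerivAt.comp x (planeRotation θ).toContinuousLinearMap.hasFDerivAt
  have h2 : φ ∘ planeRotation θ = φ := funext hinv
  rw [h2] at h1
  rw [h1.fderiv]
  rfl

theorem integral_comp_planeRotation (θ : ℝ) (f : Plane → ℂ) :
    ∫ x, f (planeRotation θ x) = ∫ x, f x :=
  ((planeRotation θ).toLinearIsometryEquiv rfl).measurePreserving.integral_comp
    ((planeRotation θ).toLinearIsometryEquiv rfl).toHomeomorph.measurableEmbedding f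

end Rotation

/-! ### The vorticity of the circular field and the decay of its gradient -/

section Curl

variable {Ω : ℝ → ℝ}

theorem partialDeriv_mul_coord {φ : Plane → ℝ} {x : Plane} (hφ : DifferentiableAt ℝ φ x)
    (i j : Fin 2) : partialDeriv i (fun y => φ y * y j) x =
      φ x * (if i = j then 1 else 0) + x j * partialDeriv i φ x := by
  have h := hφ.hasFDerivAt.mul
    (EuclideanSpace.proj (𝕜 := ℝ) (ι := Fin 2) j).hasFDerivAt (x := x)
  have h' : HasFDerivAt (fun y : Plane => φ y * y j) _ x := h
  rw [partialDeriv, h'.fderiv]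
  simp [partialDeriv, eq_comm]

/-- This is `2Ω + sΩ'` written through the derivative of `x ↦ Ω(|x|)` in the direction `x`, a form
that stays meaningful and smooth at the origin. -/
theorem curl_circularField (hΩ : Differentiable ℝ fun x : Plane => Ω ‖x‖) (x : Plane) :
    curl (circularField Ω) x = 2 * Ω ‖x‖ + fderiv ℝ (fun x : Plane => Ω ‖x‖) x x := by
  set φ : Plane → ℝ := fun x => Ω ‖x‖ with hφ
  have h1 : (fun y => circularField Ω y 1) = fun y => φ y * y 0 := by
    funext y; simp [circularField, perp, φ]
  have h0 : (fun y => circularField Ω y 0) = fun y => -(φ y * y 1) := by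
    funext y; simp [circularField, perp, φ]
  have hneg : partialDeriv 1 (fun y => -(φ y * y 1)) x = -partialDeriv 1 (fun y => φ y * y 1) x := by
    simp only [partialDeriv]
    rw [fderiv_fun_neg]; rfl
  have hx : x = x 0 • EuclideanSpace.single 0 1 + x 1 • EuclideanSpace.single 1 1 := by
    ext i; fin_cases i <;> simp
  have hxx : fderiv ℝ φ x x = x 0 * partialDeriv 0 φ x + x 1 * partialDeriv 1 φ x := by
    conv_lhs => rw [hx, map_add, map_smul, map_smul, ← hx]
    rfl
  rw [curl, h1, h0, hneg, partialDeriv_mul_coord (hΩ x), partialDeriv_mul_coord (hΩ x), hxx]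
  simp
  ring

theorem contDiff_curl_circularField
    (hΩ : ContDiff ℝ ((⊤ : ℕ∞) : WithTop ℕ∞) fun x : Plane => Ω ‖x‖) :
    ContDiff ℝ ((⊤ : ℕ∞) : WithTop ℕ∞) (curl (circularField Ω)) := by
  have h : curl (circularField Ω) =
      fun x => 2 * Ω ‖x‖ + fderiv ℝ (fun x : Plane => Ω ‖x‖) x x :=
    funext (curl_circularField (hΩ.differentiable (by simp)))
  rw [h]
  have h1 : ContDiff ℝ ((⊤ : ℕ∞) : WithTop ℕ∞) (fderiv ℝ fun x : Plane => Ω ‖x‖) :=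
    hΩ.fderiv_right (by simp)
  exact (contDiff_const.mul hΩ).add (h1.clm_apply contDiff_id)

theorem curl_circularField_planeRotation (hΩ : Differentiable ℝ fun x : Plane => Ω ‖x‖)
    (θ : ℝ) (x : Plane) :
    curl (circularField Ω) (planeRotation θ x) = curl (circularField Ω) x := by
  rw [curl_circularField hΩ, curl_circularField hΩ,
    fderiv_planeRotation hΩ (fun y => by rw [LinearIsometry.norm_map]), LinearIsometry.norm_map]

variable {α M C : ℝ}

/-- The operator `2 + s d/ds` annihilates `s^(-2)` and multiplies `s^(-α)` by `2 - α`. -/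
theorem curl_circularField_of_lt (hα₁ : α < 1) (hM : 0 < M)
    (hΩ : Differentiable ℝ fun x : Plane => Ω ‖x‖)
    (hΩM : ∀ s : ℝ, M ≤ s → Ω s = C * s ^ (-2 : ℝ) + 1 / (2 - α) * s ^ (-α))
    {x : Plane} (hx : M < ‖x‖) : curl (circularField Ω) x = ‖x‖ ^ (-α) := by
  rw [curl_circularField hΩ]
  set s := ‖x‖ with hs
  have hs0 : 0 < s := hM.trans hx
  -- The radial derivative is taken along the ray `t ↦ t x` at `t = 1`, where the explicit formula
  -- for `Ω` holds nearby.
  have h1 : HasDerivAt (fun t : ℝ => Ω ‖t • x‖) (fderiv ℝ (fun x : Plane => Ω ‖x‖) x x) 1 := by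
    have h2 : HasDerivAt (fun t : ℝ => t • x) x 1 := by
      simpa using (hasDerivAt_id (1 : ℝ)).smul_const x
    have h3 : HasFDerivAt (fun x : Plane => Ω ‖x‖) (fderiv ℝ (fun x : Plane => Ω ‖x‖) x)
        ((1 : ℝ) • x) := by
      rw [one_smul]; exact (hΩ x).hasFDerivAt
    exact h3.comp_hasDerivAt (1 : ℝ) h2
  have h2 : HasDerivAt (fun t : ℝ => C * (t * s) ^ (-2 : ℝ) + 1 / (2 - α) * (t * s) ^ (-α))
      (C * (s * (-2) * (1 * s) ^ ((-2 : ℝ) - 1)) + 1 / (2 - α) * (s * (-α) * (1 * s) ^ (-α - 1)))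
      1 := by
    have h3 : HasDerivAt (fun t : ℝ => t * s) s 1 := by
      simpa using (hasDerivAt_id (1 : ℝ)).mul_const s
    exact ((h3.rpow_const (Or.inl (by simpa using hs0.ne'))).const_mul C).add
      ((h3.rpow_const (Or.inl (by simpa using hs0.ne'))).const_mul _)
  have h3 : (fun t : ℝ => Ω ‖t • x‖) =ᶠ[nhds 1]
      fun t : ℝ => C * (t * s) ^ (-2 : ℝ) + 1 / (2 - α) * (t * s) ^ (-α) := by
    have hc : Continuous fun t : ℝ => t * s := by fun_prop
    have h4 : ∀ᶠ t : ℝ in nhds 1, M < t * s :=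
      hc.continuousAt.eventually_const_lt (by simpa using hx)
    filter_upwards [h4, lt_mem_nhds (zero_lt_one (α := ℝ))] with t ht ht0
    rw [norm_smul, Real.norm_of_nonneg (le_of_lt ht0), ← hs, hΩM _ ht.le]
  rw [h1.unique (h2.congr_of_eventuallyEq h3), hΩM s hx.le, one_mul]
  have e1 : s * s ^ ((-2 : ℝ) - 1) = s ^ (-2 : ℝ) := by
    nth_rw 1 [← Real.rpow_one s]; rw [← Real.rpow_add hs0]; norm_num
  have e2 : s * s ^ (-α - 1) = s ^ (-α) := by
    nth_rw 1 [← Real.rpow_one s]; rw [← Real.rpow_add hs0]; congr 1; ring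
  have h2α : 2 - α ≠ 0 := by linarith
  have e3 : s * (-2) * s ^ ((-2 : ℝ) - 1) = -2 * s ^ (-2 : ℝ) := by rw [← e1]; ring
  have e4 : s * (-α) * s ^ (-α - 1) = -α * s ^ (-α) := by rw [← e2]; ring
  rw [e3, e4]
  field_simp
  ring

theorem norm_fderiv_curl_circularField_le (hα₀ : 0 < α) (hα₁ : α < 1) (hM : 0 < M)
    (hΩ : Differentiable ℝ fun x : Plane => Ω ‖x‖)
    (hΩM : ∀ s : ℝ, M ≤ s → Ω s = C * s ^ (-2 : ℝ) + 1 / (2 - α) * s ^ (-α))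
    {x : Plane} (hx : M < ‖x‖) :
    ‖fderiv ℝ (curl (circularField Ω)) x‖ ≤ ‖x‖ ^ (-1 - α) := by
  have hx0 : 0 < ‖x‖ := hM.trans hx
  have h1 : curl (circularField Ω) =ᶠ[nhds x] fun y => ‖y‖ ^ (-α) := by
    filter_upwards [continuous_norm.continuousAt.eventually_const_lt hx] with y hy
    exact curl_circularField_of_lt hα₁ hM hΩ hΩM hy
  have h2 : DifferentiableAt ℝ (fun y : Plane => ‖y‖) x :=
    (contDiffAt_norm ℝ (norm_pos_iff.1 hx0)).differentiableAt (n := 1) (by simp)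
  have h3 : HasFDerivAt (fun y : Plane => ‖y‖ ^ (-α))
      ((-α * ‖x‖ ^ (-α - 1)) • fderiv ℝ (fun y : Plane => ‖y‖) x) x :=
    (Real.hasDerivAt_rpow_const (Or.inl hx0.ne')).comp_hasFDerivAt x h2.hasFDerivAt
  have h4 : ‖fderiv ℝ (fun y : Plane => ‖y‖) x‖ ≤ 1 := by
    refine norm_fderiv_le_of_lip' ℝ zero_le_one (.of_forall fun y => ?_)
    rw [one_mul]
    exact abs_norm_sub_norm_le y x
  rw [h1.fderiv_eq, h3.fderiv, norm_smul]
  have h5 : ‖-α * ‖x‖ ^ (-α - 1)‖ ≤ ‖x‖ ^ (-1 - α) := by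
    rw [norm_mul, norm_neg, Real.norm_of_nonneg hα₀.le, Real.norm_of_nonneg (by positivity),
      show -α - 1 = -1 - α by ring]
    exact mul_le_of_le_one_left (by positivity) hα₁.le
  exact (mul_le_mul h5 h4 (norm_nonneg _) (by positivity)).trans_eq (mul_one _)

theorem exists_norm_fderiv_curl_circularField_le (hα₀ : 0 < α) (hα₁ : α < 1) (hM : 0 < M)
    (hΩ : ContDiff ℝ ((⊤ : ℕ∞) : WithTop ℕ∞) fun x : Plane => Ω ‖x‖)
    (hΩM : ∀ s : ℝ, M ≤ s → Ω s = C * s ^ (-2 : ℝ) + 1 / (2 - α) * s ^ (-α)) :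
    ∃ G : ℝ, 0 ≤ G ∧ ∀ x, ‖fderiv ℝ (curl (circularField Ω)) x‖ ≤ G * (1 + ‖x‖) ^ (-1 - α) := by
  have hc : Continuous (fderiv ℝ (curl (circularField Ω))) :=
    (contDiff_curl_circularField hΩ).continuous_fderiv (by simp)
  obtain ⟨B, hB⟩ := (isCompact_closedBall (0 : Plane) (M + 1)).exists_bound_of_continuousOn
    hc.continuousOn
  have hB0 : 0 ≤ B := (norm_nonneg _).trans (hB 0 (by simp; linarith))
  have hinv : ∀ r : ℝ, 0 < r → r ^ (-1 - α) = (r ^ (1 + α))⁻¹ := fun r hr => by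
    rw [← Real.rpow_neg hr.le]; congr 1; ring
  -- The first constant serves `|x| ≤ M + 1`, where `1 + |x| ≤ 2 + M`; the second serves the
  -- exterior, where `1 + |x| ≤ 2|x|`.
  refine ⟨max (B * (2 + M) ^ (1 + α)) (2 ^ (1 + α)), le_max_of_le_right (by positivity),
    fun x => ?_⟩
  have hx1 : 0 < 1 + ‖x‖ := by positivity
  rw [hinv _ hx1, ← div_eq_mul_inv, le_div_iff₀ (by positivity)]
  rcases le_or_gt ‖x‖ (M + 1) with h | h
  · refine le_max_of_le_left (mul_le_mul (hB x (by simpa using h)) ?_ (by positivity) hB0)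
    exact Real.rpow_le_rpow hx1.le (by linarith) (by linarith)
  · refine le_max_of_le_right ?_
    have hx0 : 0 < ‖x‖ := by linarith
    have h1 := norm_fderiv_curl_circularField_le hα₀ hα₁ hM (hΩ.differentiable (by simp)) hΩM
      (by linarith : M < ‖x‖)
    rw [hinv _ hx0] at h1
    calc _ ≤ (‖x‖ ^ (1 + α))⁻¹ * (2 * ‖x‖) ^ (1 + α) :=
          mul_le_mul h1 (Real.rpow_le_rpow hx1.le (by linarith) (by linarith)) (by positivity)
            (by positivity)
      _ = 2 ^ (1 + α) := by
          rw [Real.mul_rpow (by norm_num) hx0.le]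
          have : ‖x‖ ^ (1 + α) ≠ 0 := (Real.rpow_pos_of_pos hx0 _).ne'
          field_simp

end Curl

/-! ### Absolute convergence of the Biot–Savart integral -/

section Velocity

open scoped ENNReal

/-- The Biot–Savart kernel away from the unit ball. -/
noncomputable def tailKernel (z : Plane) : Plane := if 1 ≤ ‖z‖ then biotSavartKernel z else 0

theorem nearKernel_add_tailKernel (z : Plane) :
    nearKernel 1 z + tailKernel z = biotSavartKernel z := by
  unfold nearKernel tailKernel
  rcases le_or_gt 1 ‖z‖ with h | h
  · rw [if_pos h, if_neg (not_lt.2 h), zero_add]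
  · rw [if_neg (not_le.2 h), if_pos h, add_zero]

theorem renormalizedKernel_eq (x y : Plane) :
    renormalizedKernel x y = biotSavartKernel (x - y) - tailKernel (-y) := by
  rw [renormalizedKernel, tailKernel, norm_neg]

theorem tailKernel_planeRotation (θ : ℝ) (z : Plane) :
    tailKernel (planeRotation θ z) = planeRotation θ (tailKernel z) := by
  unfold tailKernel
  rw [LinearIsometry.norm_map, biotSavartKernel_planeRotation]
  split_ifs <;> simp

theorem norm_tailKernel_le (z : Plane) : ‖tailKernel z‖ ≤ (1 + ‖z‖)⁻¹ := by
  unfold tailKernel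
  split_ifs with h
  · refine (norm_biotSavartKernel_le z).trans ?_
    rw [← one_div, ← one_div, div_div]
    exact one_div_le_one_div_of_le (by positivity) (by linarith)
  · simp only [norm_zero]; positivity

theorem measurable_coord_ofReal {k : Plane → Plane} (hk : Measurable k) (i : Fin 2) :
    Measurable fun z => ((k z i : ℝ) : ℂ) :=
  Complex.measurable_ofReal.comp ((EuclideanSpace.proj (𝕜 := ℝ) i).continuous.measurable.comp hk)

theorem measurable_tailKernel : Measurable tailKernel := by
  unfold tailKernel
  exact Measurable.ite (measurableSet_le measurable_const (by fun_prop))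
    measurable_biotSavartKernel measurable_const

theorem memLp_tailKernel {p : ℝ≥0∞} (hp : 2 < p) (hp' : p ≠ ∞) (i : Fin 2) :
    MemLp (fun z => ((tailKernel z i : ℝ) : ℂ)) p volume := by
  have hm := (measurable_coord_ofReal measurable_tailKernel i).aestronglyMeasurable (μ := volume)
  have hp2 : 2 < p.toReal := by
    rw [← ENNReal.toReal_ofNat 2]
    exact (ENNReal.toReal_lt_toReal (by simp) hp').2 hp
  rw [← integrable_norm_rpow_iff hm (by rintro rfl; simp at hp) hp']
  refine (integrable_one_add_norm_rpow (r := -p.toReal) (by linarith)).mono'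
    (hm.norm.aemeasurable.pow_const _).aestronglyMeasurable (.of_forall fun z => ?_)
  rw [Real.norm_of_nonneg (by positivity), Real.rpow_neg (by positivity),
    ← Real.inv_rpow (by positivity), Complex.norm_real]
  exact Real.rpow_le_rpow (norm_nonneg _)
    ((PiLp.norm_apply_le (tailKernel z) i).trans (norm_tailKernel_le z)) (by linarith)

/-- Hölder's inequality: the exponent conjugate to `Q` is finite because `Q > 1` and exceeds `2`
because `Q < 2`, and the tail, of size `1 / |z|`, lies in every such space. -/
theorem integrable_tailKernel_mul {Q : ℝ≥0∞} (hQ : 1 < Q) (hQ2 : Q < 2) {ω : Plane → ℂ}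
    (hω : MemLp ω Q volume) (x : Plane) (i : Fin 2) :
    Integrable fun y => ((tailKernel (x - y) i : ℝ) : ℂ) * ω y := by
  have hconj := ENNReal.HolderConjugate.conjExponent hQ.le
  set P := Q.conjExponent
  have hP : P ≠ ∞ := by
    have := hconj.symm
    exact (ENNReal.HolderConjugate.ne_top_iff_ne_one P Q).2 hQ.ne'
  have hP2 : 2 < P := by
    rw [← ENNReal.inv_lt_inv]
    by_contra! h
    have h1 : Q⁻¹ + P⁻¹ = 1 := ENNReal.HolderConjugate.inv_add_inv_eq_one Q P
    have h2 : (2 : ℝ≥0∞)⁻¹ < Q⁻¹ := ENNReal.inv_lt_inv.2 hQ2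
    have h3 : (2 : ℝ≥0∞)⁻¹ + 2⁻¹ < Q⁻¹ + P⁻¹ := ENNReal.add_lt_add_of_lt_of_le (by simp) h2 h
    rw [h1, ENNReal.inv_two_add_inv_two] at h3
    exact lt_irrefl _ h3
  have h1 : MemLp (fun y => ((tailKernel (x - y) i : ℝ) : ℂ)) P volume :=
    (memLp_tailKernel hP2 hP i).comp_measurePreserving (Measure.measurePreserving_sub_left volume x)
  have := hconj.symm
  exact h1.integrable_mul hω

theorem ae_integrable_biotSavartKernel_mul {Q : ℝ≥0∞} (hQ : 1 < Q) (hQ2 : Q < 2) (ω : L2)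
    (hω : MemLp ω Q volume) (i : Fin 2) :
    ∀ᵐ x : Plane, Integrable fun y => ((biotSavartKernel (x - y) i : ℝ) : ℂ) * ω y := by
  -- Taking `g` constantly equal to a coordinate functional makes Schur's test handle the near part
  -- of that component of `𝒦 * ω`.
  obtain ⟨K, -, hK⟩ := exists_nearOperator (g := fun _ => EuclideanSpace.proj (𝕜 := ℝ) i)
    (G := ‖EuclideanSpace.proj (𝕜 := ℝ) (ι := Fin 2) i‖) continuous_const (norm_nonneg _)
    fun _ => le_rfl
  obtain ⟨T, -, hT⟩ := hK 1 one_pos le_rfl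
  filter_upwards [hT ω] with x hx
  refine (hx.1.add (integrable_tailKernel_mul hQ hQ2 hω x i)).congr (.of_forall fun y => ?_)
  simp only [Pi.add_apply]
  rw [← nearKernel_add_tailKernel]
  simp [pairKernel, add_mul]

theorem ae_velocityExistsAt {Q : ℝ≥0∞} (hQ : 1 < Q) (hQ2 : Q < 2) (ω : L2)
    (hω : MemLp ω Q volume) : ∀ᵐ x : Plane, VelocityExistsAt ω x := by
  filter_upwards [ae_all_iff.2 (ae_integrable_biotSavartKernel_mul hQ hQ2 ω hω)] with x hx i
  have h := (integrable_comp_sub_left _ x).2 (hx i)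
  simpa [ConvolutionExistsAt] using h

theorem velocity_eq (ω : Plane → ℂ) (x : Plane) (i : Fin 2) :
    velocity ω x i = ∫ y, ((biotSavartKernel (x - y) i : ℝ) : ℂ) * ω y := by
  rw [velocity, convolution_lsmul_swap]
  simp

end Velocity

/-! ### Consequences of the `m`-fold symmetry -/

section Symmetry

open scoped ENNReal

theorem mem_L2m_iff {m : ℕ} {ω : L2} : ω ∈ L2m m ↔
    ∀ᵐ x ∂(volume : Measure Plane), ω x = ω (planeRotation (-(2 * Real.pi / m)) x) :=
  Iff.rfl

/-- Rotating the variable of integration shows that the vector of these integrals is fixed by a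
rotation which, as `m ≥ 2`, is not the identity; such a vector is zero. -/
theorem integral_tailKernel_mul_eq_zero {m : ℕ} (hm : 2 ≤ m) {Q : ℝ≥0∞} (hQ : 1 < Q) (hQ2 : Q < 2)
    {ω : L2} (hωm : ω ∈ L2m m) (hω : MemLp ω Q volume) (i : Fin 2) :
    ∫ y, ((tailKernel (-y) i : ℝ) : ℂ) * ω y = 0 := by
  set θ : ℝ := -(2 * Real.pi / m)
  set I : Fin 2 → ℂ := fun i => ∫ y, ((tailKernel (-y) i : ℝ) : ℂ) * ω y
  have hint : ∀ i, Integrable fun y => ((tailKernel (-y) i : ℝ) : ℂ) * ω y := fun i => by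
    simpa using integrable_tailKernel_mul hQ hQ2 hω 0 i
  have hrot : ∀ i, I i = ∫ y, ((planeRotation θ (tailKernel (-y)) i : ℝ) : ℂ) * ω y := fun i => by
    simp only [I]
    rw [← integral_comp_planeRotation θ]
    refine integral_congr_ae ?_
    filter_upwards [mem_L2m_iff.1 hωm] with y hy
    rw [← hy, ← map_neg, tailKernel_planeRotation]
  have h0 : I 0 = Real.cos θ * I 0 - Real.sin θ * I 1 := by
    refine (hrot 0).trans ?_
    simp only [I]
    rw [← integral_const_mul, ← integral_const_mul, ← integral_sub ((hint 0).const_mul _)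
      ((hint 1).const_mul _)]
    refine integral_congr_ae (.of_forall fun y => ?_)
    simp only [planeRotation_apply_zero]
    push_cast; ring
  have h1 : I 1 = Real.sin θ * I 0 + Real.cos θ * I 1 := by
    refine (hrot 1).trans ?_
    simp only [I]
    rw [← integral_const_mul, ← integral_const_mul, ← integral_add ((hint 0).const_mul _)
      ((hint 1).const_mul _)]
    refine integral_congr_ae (.of_forall fun y => ?_)
    simp only [planeRotation_apply_one]
    push_cast; ring
  have hcos : Real.cos θ < 1 := by
    have hm' : (2 : ℝ) ≤ m := by exact_mod_cast hm
    have h := Real.cos_lt_cos_of_nonneg_of_le_pi (x := 0) (y := 2 * Real.pi / m) le_rfl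
      (by rw [div_le_iff₀ (by linarith)]; nlinarith [Real.pi_pos])
      (div_pos (by linarith [Real.pi_pos]) (by linarith))
    rwa [Real.cos_zero, ← Real.cos_neg] at h
  -- The determinant of the identity minus the rotation; the combinations below are Cramer's rule.
  have hdet : (((1 - Real.cos θ) ^ 2 + Real.sin θ ^ 2 : ℝ) : ℂ) ≠ 0 := by
    have : 0 < (1 - Real.cos θ) ^ 2 := pow_pos (by linarith) 2
    exact_mod_cast (by positivity : (1 - Real.cos θ) ^ 2 + Real.sin θ ^ 2 ≠ 0)
  have hI : ∀ i, (((1 - Real.cos θ) ^ 2 + Real.sin θ ^ 2 : ℝ) : ℂ) * I i = 0 := by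
    intro i
    rw [Complex.ofReal_add, Complex.ofReal_pow, Complex.ofReal_pow, Complex.ofReal_sub,
      Complex.ofReal_one]
    fin_cases i
    · change _ * I 0 = 0
      linear_combination (1 - (Real.cos θ : ℂ)) * h0 - (Real.sin θ : ℂ) * h1
    · change _ * I 1 = 0
      linear_combination (Real.sin θ : ℂ) * h0 + (1 - (Real.cos θ : ℂ)) * h1
  exact (mul_eq_zero.1 (hI i)).resolve_left hdet

theorem IsIntegralOperator.apply_mem_L2m {k : Plane → Plane → ℂ} {T : L2 →L[ℂ] L2} {m : ℕ}
    (hT : IsIntegralOperator k T) (hk : ∀ x y, k (planeRotation (-(2 * Real.pi / m)) x)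
      (planeRotation (-(2 * Real.pi / m)) y) = k x y) {ω : L2} (hω : ω ∈ L2m m) :
    T ω ∈ L2m m := by
  rw [mem_L2m_iff] at hω ⊢
  set θ : ℝ := -(2 * Real.pi / m)
  have h := (measurePreserving_planeRotation θ).quasiMeasurePreserving.ae (hT ω)
  filter_upwards [hT ω, h] with x h1 h2
  rw [h1.2, h2.2, ← integral_comp_planeRotation θ fun y => k (planeRotation θ x) y * ω y]
  refine integral_congr_ae ?_
  filter_upwards [hω] with y hy
  rw [hk, ← hy]

/-- Truncation to balls about the origin preserves the symmetry, lands in `L^Q` because balls have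
finite measure, and converges in `L²`. -/
theorem dense_LQm {Q : ℝ≥0∞} (hQ2 : Q < 2) (m : ℕ) : Dense (LQm Q m) := by
  intro ω
  set θ : ℝ := -(2 * Real.pi / m)
  set S : ℕ → Set Plane := fun n => Metric.closedBall 0 n
  have hS : ∀ n, MeasurableSet (S n) := fun n => measurableSet_closedBall
  have hmem : ∀ n, MemLp ((S n).indicator (ω : L2)) 2 volume := fun n =>
    (Lp.memLp (ω : L2)).indicator (hS n)
  have hmemQ : ∀ n, MemLp ((S n).indicator (ω : L2)) Q volume := fun n => by
    rw [memLp_indicator_iff_restrict (hS n)]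
    have : IsFiniteMeasure ((volume : Measure Plane).restrict (S n)) :=
      ⟨by rw [Measure.restrict_apply_univ]; exact measure_closedBall_lt_top⟩
    exact ((Lp.memLp (ω : L2)).restrict (S n)).mono_exponent hQ2.le
  have hL2m : ∀ n, (hmem n).toLp _ ∈ L2m m := fun n => by
    rw [mem_L2m_iff]
    have h1 := (hmem n).coeFn_toLp
    have h2 := (measurePreserving_planeRotation θ).quasiMeasurePreserving.ae h1
    filter_upwards [h1, h2, mem_L2m_iff.1 ω.2] with x h3 h4 h5
    rw [h3, h4]
    simp only [Set.indicator, S, mem_closedBall_zero_iff, LinearIsometry.norm_map]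
    rw [h5]
  set u : ℕ → L2m m := fun n => ⟨(hmem n).toLp _, hL2m n⟩
  have hu : ∀ n, u n ∈ LQm Q m := fun n => (hmemQ n).ae_eq (hmem n).coeFn_toLp.symm
  refine mem_closure_of_tendsto (f := u) (b := Filter.atTop) ?_ (.of_forall hu)
  rw [tendsto_iff_norm_sub_tendsto_zero]
  have hnorm : ∀ n, ‖u n - ω‖ ^ 2 =
      (∫⁻ x, ‖(S n).indicator (ω : L2) x - (ω : L2) x‖ₑ ^ 2).toReal := fun n => by
    rw [← ENNReal.toReal_ofReal (sq_nonneg ‖u n - ω‖)]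
    change (ENNReal.ofReal (‖(hmem n).toLp _ - (ω : L2)‖ ^ 2)).toReal = _
    rw [ofReal_norm_Lp_two_sq]
    congr 1
    refine lintegral_congr_ae ?_
    filter_upwards [Lp.coeFn_sub ((hmem n).toLp _) (ω : L2), (hmem n).coeFn_toLp] with x h1 h2
    rw [h1, Pi.sub_apply, h2]
  have hωm : Measurable (ω : L2) := (Lp.stronglyMeasurable (ω : L2)).measurable
  have hlim : Filter.Tendsto
      (fun n => ∫⁻ x, ‖(S n).indicator (ω : L2) x - (ω : L2) x‖ₑ ^ 2) Filter.atTop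
      (nhds (∫⁻ _ : Plane, 0)) := by
    refine tendsto_lintegral_of_dominated_convergence (fun x => ‖(ω : L2) x‖ₑ ^ 2)
      (fun n => ((hωm.indicator (hS n)).sub hωm).enorm.pow_const 2)
      (fun n => .of_forall fun x => ?_) ?_ (.of_forall fun x => ?_)
    · by_cases hx : x ∈ S n <;> simp [hx]
    · rw [← ofReal_norm_Lp_two_sq]; simp
    · refine tendsto_const_nhds.congr' ?_
      obtain ⟨N, hN⟩ := exists_nat_ge ‖x‖
      filter_upwards [Filter.eventually_ge_atTop N] with n hn
      have hx : x ∈ S n := by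
        simp only [S, mem_closedBall_zero_iff]
        exact hN.trans (by exact_mod_cast hn)
      simp [hx]
  rw [lintegral_zero] at hlim
  have h2 : Filter.Tendsto (fun n => ‖u n - ω‖ ^ 2) Filter.atTop (nhds 0) := by
    simp_rw [hnorm]
    rw [← ENNReal.toReal_zero]
    exact (ENNReal.tendsto_toReal ENNReal.zero_ne_top).comp hlim
  have h3 := h2.sqrt
  simpa [Real.sqrt_sq (norm_nonneg _)] using h3

end Symmetry

/-! ### Identification of the operator and conclusion -/

section Main

theorem pairKernel_eq_sum (g : Plane → Plane →L[ℝ] ℝ) (k : Plane → Plane → Plane) (x y : Plane) :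
    pairKernel g k x y =
      ∑ i : Fin 2, ((k x y i : ℝ) : ℂ) * ((g x (EuclideanSpace.single i 1) : ℝ) : ℂ) := by
  have hx : k x y = k x y 0 • EuclideanSpace.single 0 1 + k x y 1 • EuclideanSpace.single 1 1 := by
    ext i; fin_cases i <;> simp
  rw [pairKernel]
  conv_lhs => rw [hx, map_add, map_smul, map_smul]
  simp

theorem ae_eq_vorticityStretch {V : Plane → Plane} {T : L2 →L[ℂ] L2}
    (hT : IsIntegralOperator (pairKernel (fderiv ℝ (curl V)) renormalizedKernel) T)
    {m : ℕ} (hm : 2 ≤ m) {Q : ENNReal} (hQ : 1 < Q) (hQ2 : Q < 2) {ω : L2} (hωm : ω ∈ L2m m)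
    (hω : MemLp ω Q volume) : T ω =ᵐ[volume] vorticityStretch V ω := by
  have htail : ∀ i, Integrable fun y => ((tailKernel (-y) i : ℝ) : ℂ) * ω y := fun i => by
    simpa using integrable_tailKernel_mul hQ hQ2 hω 0 i
  filter_upwards [hT ω, ae_all_iff.2 (ae_integrable_biotSavartKernel_mul hQ hQ2 ω hω)] with x h1 h2
  have h3 : ∀ i, ∫ y, ((renormalizedKernel x y i : ℝ) : ℂ) * ω y = velocity ω x i := fun i => by
    rw [velocity_eq, ← sub_zero (∫ y, ((biotSavartKernel (x - y) i : ℝ) : ℂ) * ω y),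
      ← integral_tailKernel_mul_eq_zero hm hQ hQ2 hωm hω i, ← integral_sub (h2 i) (htail i)]
    refine integral_congr_ae (.of_forall fun y => ?_)
    simp only [renormalizedKernel_eq, PiLp.sub_apply]
    push_cast; ring
  have h4 : ∀ i, Integrable fun y => ((renormalizedKernel x y i : ℝ) : ℂ) * ω y := fun i => by
    refine ((h2 i).sub (htail i)).congr (.of_forall fun y => ?_)
    simp only [renormalizedKernel_eq, PiLp.sub_apply, Pi.sub_apply]
    push_cast; ring
  rw [h1.2, vorticityStretch]
  simp_rw [← h3, ← integral_mul_const]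
  rw [← integral_finsetSum _ fun i _ => (h4 i).mul_const _]
  refine integral_congr_ae (.of_forall fun y => ?_)
  simp only [pairKernel_eq_sum, Finset.sum_mul, partialDeriv]
  exact Finset.sum_congr rfl fun i _ => by ring

end Main

theorem proposition2p1 (α M C : ℝ) (hα₀ : 0 < α) (hα₁ : α < 1) (hM : 0 < M)
    (Ω : ℝ → ℝ) (hΩ : ContDiff ℝ ((⊤ : ℕ∞) : WithTop ℕ∞) fun x : Plane => Ω ‖x‖)
    (hΩM : ∀ s : ℝ, M ≤ s → Ω s = C * s ^ (-2 : ℝ) + 1 / (2 - α) * s ^ (-α))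
    (m : ℕ) (hm : 2 ≤ m) :
    ∃ A : L2m m →L[ℂ] L2m m,
      (∀ Q : ENNReal, 1 < Q → Q < 2 →
        Dense (LQm Q m) ∧
        ∀ ω ∈ LQm Q m,
          (∀ᵐ x ∂(volume : Measure Plane), VelocityExistsAt (ω : L2) x) ∧
          ((A ω : L2) : Plane → ℂ) =ᵐ[volume]
            vorticityStretch (circularField Ω) (ω : L2)) ∧
      IsCompactOperator A ∧
      ∀ p : ℝ, 2 < p → MemSchatten p A := by
  have hdiff : Differentiable ℝ fun x : Plane => Ω ‖x‖ := hΩ.differentiable (by simp)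
  have hcurl := contDiff_curl_circularField hΩ
  set g := fderiv ℝ (curl (circularField Ω))
  have hg : Continuous g := hcurl.continuous_fderiv (by simp)
  obtain ⟨G, hG, hgG⟩ := exists_norm_fderiv_curl_circularField_le hα₀ hα₁ hM hΩ hΩM
  obtain ⟨T, hT, hTB⟩ := exists_stretchOperator hg hα₀ hG hgG
  have hinv : ∀ x y, pairKernel g renormalizedKernel (planeRotation (-(2 * Real.pi / m)) x)
      (planeRotation (-(2 * Real.pi / m)) y) = pairKernel g renormalizedKernel x y := by
    intro x y
    rw [pairKernel, renormalizedKernel_planeRotation,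
      fderiv_planeRotation (hcurl.differentiable (by simp))
        (curl_circularField_planeRotation hdiff _), pairKernel]
  set A : L2m m →L[ℂ] L2m m :=
    (T ∘L (L2m m).subtypeL).codRestrict (L2m m) fun ω => hT.apply_mem_L2m hinv ω.2
  have hA : ∀ ω, ((A ω : L2m m) : L2) = T ω := fun ω => rfl
  have hS : ∀ p : ℝ, 2 < p → MemSchatten p A := by
    intro p hp
    -- Small enough for the approximation (`δ ≤ 4`, `δ < 4α`) and for `2 + δ < p`.
    set δ : ℝ := min (min 4 (2 * α)) ((p - 2) / 2)
    have hδ : 0 < δ := lt_min (by positivity) (by linarith)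
    have hδ1 : δ ≤ 4 := (min_le_left _ _).trans (min_le_left _ _)
    have hδ2 : δ ≤ 2 * α := (min_le_left _ _).trans (min_le_right _ _)
    have hδ3 : δ ≤ (p - 2) / 2 := min_le_right _ _
    obtain ⟨K, D, h⟩ := hTB δ hδ hδ1 (by linarith)
    refine memSchatten_of_approx A (K := K) (D := D) hδ.le (by linarith) fun t ht ht1 => ?_
    obtain ⟨B, hTB, hB⟩ := h t ht ht1
    set P := (L2m m).orthogonalProjectionOnto
    have hP : ∀ x, ‖P x‖ ≤ ‖x‖ := fun x =>
      (P.le_opNorm x).trans (mul_le_of_le_one_left (norm_nonneg _)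
        (L2m m).orthogonalProjectionOnto_norm_le)
    -- The approximant is compressed to the symmetric subspace. The projection is a contraction that
    -- fixes the values of `A`, so neither the error nor the Hilbert–Schmidt bound gets worse.
    refine ⟨P ∘L B ∘L (L2m m).subtypeL, ?_, fun ι _ e he => ?_⟩
    · refine ContinuousLinearMap.opNorm_le_bound _ ((norm_nonneg _).trans hTB) fun ω => ?_
      have h1 : (A - P ∘L B ∘L (L2m m).subtypeL) ω = P ((T - B) ω) := by
        have h2 : P (A ω : L2) = A ω :=
          Submodule.orthogonalProjectionOnto_mem_subspace_eq_self (A ω)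
        rw [hA] at h2
        rw [sub_apply, sub_apply, map_sub, h2]
        rfl
      rw [h1]
      exact (hP _).trans (((T - B).le_opNorm _).trans
        (mul_le_mul_of_nonneg_right hTB (norm_nonneg _)))
    · refine le_trans (Finset.sum_le_sum fun i _ => ?_)
        (hB ι _ (he.comp_linearIsometry (L2m m).subtypeₗᵢ))
      exact pow_le_pow_left₀ (norm_nonneg _) (hP _) 2
  refine ⟨A, fun Q hQ hQ2 => ⟨dense_LQm hQ2 m, fun ω hω => ⟨?_, ?_⟩⟩, (hS 3 (by norm_num)).1, hS⟩
  · exact ae_velocityExistsAt hQ hQ2 ω hω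
  · rw [hA]
    exact ae_eq_vorticityStretch hT hm hQ hQ2 ω.2 hω
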